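/- Let $K$ be a field of characteristic different from $2$ and $3$, and let $E: y^2=x^3+Ax+B$ and $\tilde E: y^2=x^3+\tilde A x+\tilde B$ be elliptic curves over $K$. An isogeny $I:E\to\tilde E$ (over $K$) is a non-zero regular map, defined over $K$, that is a group morphism $E(\overline K)\to\tilde E(\overline K)$; its degree is $\ell=[K(E):I^*K(\tilde E)]$. It is called normalized if there is a rational function $I_x\in K(x)$ with $I(x,y)=(I_x(x),\,y\,I_x'(x))$ for all affine points $(x,y)$ of $E$ at which $I_x$ has no pole. Proposition. Let $I:E\to\tilde E$ be a normalized isogeny of degree $\ell$, let $F\subset E(\overline K)$ be its kernel and $F^*=F\setminus\{O_E\}$, and write $x_Q$ for the abscissa of $Q\in F^*$. Then $F$ is finite, the polynomial $$D(x)=\prod_{Q\in F^*}(x-x_Q)=x^{\ell-1}-\sigma x^{\ell-2}+\cdots,\qquad \sigma=\sum_{Q\in F^*}x_Q,$$ has degree $\ell-1$ and coefficients in $K$, and there is a polynomial $N\in K[x]$ such that $$\frac{N(x)}{D(x)}=\ell x-\sigma-(3x^2+A)\frac{D'(x)}{D(x)}-2(x^3+Ax+B)\left(\frac{D'(x)}{D(x)}\right)'$$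 and $$I(x,y)=\left(\frac{N(x)}{D(x)},\;y\left(\frac{N(x)}{D(x)}\right)'\right)$$ for all affine points $(x,y)$ of $E$ at which $N/D$ has no pole. -/

import Mathlib

open Polynomial

noncomputable section

namespace RatFunc

/-- The formal derivative `u'` of a rational function `u`, by the quotient rule applied to its
expression in lowest terms (`deriv_div` shows that every other expression gives the same). -/
def deriv {K : Type*} [Field K] (u : RatFunc K) : RatFunc K :=
  (algebraMap K[X] (RatFunc K) (derivative u.num) * algebraMap K[X] (RatFunc K) u.denom
    - algebraMap K[X] (RatFunc K) u.num * algebraMap K[X] (RatFunc K) (derivative u.denom))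
    / algebraMap K[X] (RatFunc K) u.denom ^ 2

theorem deriv_div {K : Type*} [Field K] (p q : K[X]) (hq : q ≠ 0) :
    RatFunc.deriv (algebraMap K[X] (RatFunc K) p / algebraMap K[X] (RatFunc K) q) =
      (algebraMap K[X] (RatFunc K) (derivative p) * algebraMap K[X] (RatFunc K) q
        - algebraMap K[X] (RatFunc K) p * algebraMap K[X] (RatFunc K) (derivative q))
        / algebraMap K[X] (RatFunc K) q ^ 2 := by
  set u : RatFunc K := algebraMap K[X] (RatFunc K) p / algebraMap K[X] (RatFunc K) q with hu
  have hq' : algebraMap K[X] (RatFunc K) q ≠ 0 := RatFunc.algebraMap_ne_zero hq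
  have hd' : algebraMap K[X] (RatFunc K) u.denom ≠ 0 :=
    RatFunc.algebraMap_ne_zero u.denom_ne_zero
  have h1 : u.num * q = p * u.denom := (RatFunc.num_mul_eq_mul_denom_iff hq).mpr hu
  have h2 := congrArg derivative h1
  rw [derivative_mul, derivative_mul] at h2
  have e1 := congrArg (algebraMap K[X] (RatFunc K)) h1
  have e2 := congrArg (algebraMap K[X] (RatFunc K)) h2
  simp only [map_mul, map_add] at e1 e2
  rw [RatFunc.deriv, div_eq_div_iff (pow_ne_zero 2 hd') (pow_ne_zero 2 hq')]
  linear_combination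
    (algebraMap K[X] (RatFunc K) u.denom * algebraMap K[X] (RatFunc K) q) * e2
      - (algebraMap K[X] (RatFunc K) (derivative u.denom) * algebraMap K[X] (RatFunc K) q
        + algebraMap K[X] (RatFunc K) u.denom * algebraMap K[X] (RatFunc K) (derivative q)) * e1

end RatFunc

namespace WeierstrassCurve

/-- The group `E(K̄)` of points of `E` over the algebraic closure of its field of definition. -/
abbrev GeomPoint {K : Type*} [Field K] (E : WeierstrassCurve K) : Type _ :=
  (E.baseChange (AlgebraicClosure K)).toAffine.Point

namespace GeomPoint

/-- Homogeneous coordinates in the projective plane: `O = [0 : 1 : 0]`, `(x, y) = [x : y : 1]`. -/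
def coords {K : Type*} [Field K] {E : WeierstrassCurve K} :
    E.GeomPoint → Fin 3 → AlgebraicClosure K
  | .zero => ![0, 1, 0]
  | .some x y _ => ![x, y, 1]

/-- The abscissa `x_Q` of an affine point `Q` (and `0` at `O`, where it is never used). -/
def abscissa {K : Type*} [Field K] {E : WeierstrassCurve K} : E.GeomPoint → AlgebraicClosure K
  | .zero => 0
  | .some x _ _ => x

end GeomPoint

/-- A map `E(K̄) → E'(K̄)` is regular (over `K`) if around every point `P` it is given by a triple
of homogeneous polynomials of one degree with coefficients in `K`, not all vanishing at `P`:
at every `Q` the triple is proportional to the homogeneous coordinates of the image of `Q`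
(with factor `0` only where the whole triple vanishes). -/
def IsRegularMap {K : Type*} [Field K] {E E' : WeierstrassCurve K}
    (φ : E.GeomPoint → E'.GeomPoint) : Prop :=
  ∀ P : E.GeomPoint, ∃ (d : ℕ) (G : Fin 3 → MvPolynomial (Fin 3) K),
    (∀ i, (G i).IsHomogeneous d) ∧
    (∃ i, MvPolynomial.aeval P.coords (G i) ≠ 0) ∧
    ∀ Q : E.GeomPoint, ∃ c : AlgebraicClosure K,
      ∀ i, MvPolynomial.aeval Q.coords (G i) = c * (φ Q).coords i

open scoped Classical in
/-- An isogeny: a non-zero regular map that is also a group morphism. -/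
structure Isogeny {K : Type*} [Field K] (E E' : WeierstrassCurve K) where
  toHom : E.GeomPoint →+ E'.GeomPoint
  regular : IsRegularMap toHom
  ne_zero : toHom ≠ 0

/-- The element `f` of the function field `K(E)` is regular at the affine point `(x, y)` and takes
the value `z` there: `f = p / q` with `q (x, y) ≠ 0` and `z = p (x, y) / q (x, y)`. -/
def HasValueAt {K : Type*} [Field K] {E : WeierstrassCurve K} (f : E.toAffine.FunctionField)
    (x y z : AlgebraicClosure K) : Prop :=
  ∃ p q : K[X][X],
    algebraMap E.toAffine.CoordinateRing E.toAffine.FunctionField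
        (Affine.CoordinateRing.mk E.toAffine q) * f =
      algebraMap E.toAffine.CoordinateRing E.toAffine.FunctionField
        (Affine.CoordinateRing.mk E.toAffine p) ∧
    aevalAeval x y q ≠ 0 ∧
    z = aevalAeval x y p / aevalAeval x y q

namespace Isogeny

variable {K : Type*} [Field K] {E E' : WeierstrassCurve K}

/-- `g = f ∘ I` as rational functions on `E`. -/
def IsPullback (I : Isogeny E E') (f : E'.toAffine.FunctionField)
    (g : E.toAffine.FunctionField) : Prop :=
  ∀ (x y : AlgebraicClosure K) (h : (E.baseChange (AlgebraicClosure K)).toAffine.Nonsingular x y)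
    (x' y' : AlgebraicClosure K)
    (h' : (E'.baseChange (AlgebraicClosure K)).toAffine.Nonsingular x' y'),
    I.toHom (.some x y h) = .some x' y' h' →
    ∀ z, HasValueAt f x' y' z → HasValueAt g x y z

/-- The subfield `I^* K(E')` of `K(E)` formed by the functions `f ∘ I`, `f ∈ K(E')`. -/
def pullbackField (I : Isogeny E E') : IntermediateField K E.toAffine.FunctionField :=
  IntermediateField.adjoin K {g | ∃ f, I.IsPullback f g}

/-- The degree `[K(E) : I^* K(E')]` of an isogeny. -/
def degree (I : Isogeny E E') : ℕ :=
  Module.finrank I.pullbackField E.toAffine.FunctionField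

/-- `F* = F \ {O}`, where `F ⊆ E(K̄)` is the kernel of `I`. -/
def kernelStar (I : Isogeny E E') : Set E.GeomPoint :=
  {Q | I.toHom Q = 0 ∧ Q ≠ 0}

/-- `I (x, y) = (u (x), c y u' (x))`, at all affine points where `u` has no pole. -/
def HasForm (I : Isogeny E E') (u : RatFunc K) (c : K) : Prop :=
  ∀ (x y : AlgebraicClosure K) (h : (E.baseChange (AlgebraicClosure K)).toAffine.Nonsingular x y),
    aeval x u.denom ≠ 0 →
    ∃ h', I.toHom (.some x y h) =
      .some (u.eval (algebraMap K (AlgebraicClosure K)) x)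
        (algebraMap K (AlgebraicClosure K) c * y *
          u.deriv.eval (algebraMap K (AlgebraicClosure K)) x) h'

/-- An isogeny is normalized if it has the form `(x, y) ↦ (I_x (x), c y I_x' (x))` with `c = 1`. -/
def IsNormalized (I : Isogeny E E') : Prop :=
  ∃ u : RatFunc K, I.HasForm u 1

end Isogeny

end WeierstrassCurve

end

/-! Write the abscissa map as `u = n / d` in lowest terms with `d` monic, let `f = x^3 + A x + B`,
and work over the algebraic closure. Since `(u, y u')` lies on the target curve, `f u'^2 = u^3 + A'
u + B'` (`IsShortODE`). All the information about `n` comes from expanding this equation at the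
poles of `u`.

At a root `r` of `d` the order of the pole is forced: 1 if `f r = 0`, 2 otherwise. This is exactly
the number of points of abscissa `r`. Regularity of the isogeny shows that the roots of `d` are the
abscissas of the non-zero kernel points, so `d` is the kernel polynomial `D`
(`HasGeomForm.roots_eq`). The equation also fixes enough of the principal part of `u` at `r` to make
`veluDefect`, the difference of the two sides of the desired formula times `d^2`, divisible by `d^2`
(`IsShortODE.sq_dvd_veluDefect`).

At infinity the equation gives `n = X d + s` with `deg s < deg d`, once `deg n > deg d` is known.
Expanding `d' / d` to two terms then gives `veluDefect` degree less than `2 deg d`, so it vanishes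
(`IsShortODE.veluDefect_eq_zero`).

That `u` has a pole at infinity is where the group law enters: compatibility with doubling,
evaluated at a 2-torsion abscissa, rules out a finite value (`HasGeomForm.natDegree_lt`).

Finally `ℓ = deg d + 1`. The pullback field is `K(u, y u')`, and comparing it with `K(u)` and `K(x)`
inside `K(E)` shows that `ℓ` is the degree of `u` as a rational function (`HasForm.degree_eq`). -/

noncomputable section

/-! ### The differential equation near a finite pole -/

namespace Polynomial

variable {F : Type*} [Field F]

theorem X_sub_C_sq_dvd {p : F[X]} {r : F} (h0 : p.eval r = 0) (h1 : (derivative p).eval r = 0) :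
    (X - C r) ^ 2 ∣ p := by
  obtain ⟨q, rfl⟩ := dvd_iff_isRoot.mpr h0
  have hq : q.eval r = 0 := by simpa [derivative_mul] using h1
  rw [pow_two]
  exact mul_dvd_mul_left _ (dvd_iff_isRoot.mpr hq)

/-- The numerator of `g - f' (d' / d) - 2 f (d' / d)' - n / d` over the denominator `d ^ 2`. -/
def veluDefect (f g n d : F[X]) : F[X] :=
  g * d ^ 2 - derivative f * derivative d * d
    - 2 * f * (derivative (derivative d) * d - derivative d ^ 2) - n * d

/-- The equation `f u' ^ 2 = u ^ 3 + A u + B` for `u = n / d`, cleared of denominators. -/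
def IsShortODE (f n d : F[X]) (A B : F) : Prop :=
  f * (derivative n * d - n * derivative d) ^ 2 =
    d * (n ^ 3 + C A * n * d ^ 2 + C B * d ^ 3)

theorem derivative_X_sub_C_pow_mul (r : F) (m : ℕ) (e : F[X]) :
    derivative ((X - C r) ^ (m + 1) * e) =
      (X - C r) ^ m * (((m + 1 : ℕ) : F[X]) * e + (X - C r) * derivative e) := by
  rw [derivative_mul, derivative_X_sub_C_pow]
  simp
  ring

/-- Compare orders at `r`. If `d` has order `m ≥ 1`, the right side has order exactly `m`, because
`n` does not vanish there, while the left side has order at least `2 (m - 1)`. So `m ≤ 2`, and the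
value of `f` at `r` separates the two remaining cases. -/
theorem IsShortODE.exists_eq_pow_mul {f n d : F[X]} {A B : F} (h : IsShortODE f n d A B)
    (hd0 : d ≠ 0) {r : F} (hn : n.eval r ≠ 0) (hd : d.eval r = 0) :
    (f.eval r = 0 ∧ ∃ e, d = (X - C r) * e ∧ e.eval r ≠ 0) ∨
    (f.eval r ≠ 0 ∧ ∃ e, d = (X - C r) ^ 2 * e ∧ e.eval r ≠ 0) := by
  obtain ⟨e, hde, he⟩ := exists_eq_pow_rootMultiplicity_mul_and_not_dvd d hd0 r
  rw [dvd_iff_isRoot, IsRoot.def] at he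
  set m := rootMultiplicity r d with hm
  clear_value m
  have ht : (X - C r) ≠ 0 := X_sub_C_ne_zero r
  match m, hde with
  | 0, hde =>
    rw [hde] at hd
    simp at hd
    exact absurd hd he
  | 1, hde =>
    rw [pow_one] at hde
    left
    refine ⟨?_, e, hde, he⟩
    unfold IsShortODE at h
    by_contra hf
    have h1 := congrArg (eval r) h
    rw [hde] at h1
    simp [derivative_mul, hf, hn, he] at h1
  | 2, hde =>
    right
    refine ⟨?_, e, hde, he⟩
    unfold IsShortODE at h
    have h1 : f * (derivative n * (X - C r) * e - 2 * n * e - n * (X - C r) * derivative e) ^ 2 =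
        e * (n ^ 3 + C A * n * d ^ 2 + C B * d ^ 3) := by
      apply mul_left_cancel₀ (pow_ne_zero 2 ht)
      have hd' : derivative d = (X - C r) * (2 * e + (X - C r) * derivative e) := by
        rw [hde, derivative_X_sub_C_pow_mul]
        push_cast
        ring
      rw [hd', hde] at h
      rw [hde]
      linear_combination h
    intro hf
    have h2 := congrArg (eval r) h1
    simp [hf, hd, hn, he] at h2
  | m + 3, hde =>
    exfalso
    unfold IsShortODE at h
    have h1 : f * (X - C r) ^ (m + 1) * (derivative n * (X - C r) * e - ((m + 3 : ℕ) : F[X]) * n * e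
        - n * (X - C r) * derivative e) ^ 2 =
        e * (n ^ 3 + C A * n * d ^ 2 + C B * d ^ 3) := by
      apply mul_left_cancel₀ (pow_ne_zero (m + 3) ht)
      have hd' : derivative d = (X - C r) ^ (m + 2) *
          (((m + 3 : ℕ) : F[X]) * e + (X - C r) * derivative e) := by
        rw [hde, derivative_X_sub_C_pow_mul]
      rw [hd', hde] at h
      rw [hde]
      linear_combination h
    have h2 := congrArg (eval r) h1
    simp [hd, hn, he] at h2

/-- Here `r` is a 2-torsion abscissa. Modulo `(X - r)^2` only the residue of `u` matters, and the
equation gives it to leading order. The polynomial `g` is arbitrary because it enters multiplied by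
`d^2`. -/
theorem IsShortODE.dvd_veluDefect_of_simple {f n d e : F[X]} {A B : F} (g : F[X])
    (h : IsShortODE f n d A B) {r : F} (hn : n.eval r ≠ 0) (hf : f.eval r = 0)
    (hd : d = (X - C r) * e) (he : e.eval r ≠ 0) :
    (X - C r) ^ 2 ∣ veluDefect f g n d := by
  obtain ⟨f₁, rfl⟩ := dvd_iff_isRoot.mpr hf
  have ht : (X - C r) ≠ 0 := X_sub_C_ne_zero r
  have h1 : f₁ * (derivative n * d - n * derivative d) ^ 2 =
      e * (n ^ 3 + C A * n * d ^ 2 + C B * d ^ 3) := by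
    apply mul_left_cancel₀ ht
    unfold IsShortODE at h
    linear_combination h + hd * (n ^ 3 + C A * n * d ^ 2 + C B * d ^ 3)
  have h2 : (f₁ * e - n).eval r = 0 := by
    have h3 := congrArg (eval r) h1
    simp [hd] at h3
    have : (e.eval r * n.eval r ^ 2) * (f₁.eval r * e.eval r - n.eval r) = 0 := by
      linear_combination h3
    simpa [he, hn] using this
  obtain ⟨q, hq⟩ := dvd_iff_isRoot.mpr h2
  obtain rfl : n = f₁ * e - (X - C r) * q := by rw [← hq]; ring
  refine ⟨g * e ^ 2 - derivative f₁ * e ^ 2 - f₁ * derivative e * e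
    - derivative f₁ * (X - C r) * derivative e * e
    - 2 * f₁ * ((2 * derivative e + (X - C r) * derivative (derivative e)) * e -
      2 * e * derivative e - (X - C r) * derivative e ^ 2) + q * e, ?_⟩
  rw [veluDefect, hd]
  simp only [derivative_mul, derivative_sub, derivative_X, derivative_C, derivative_add]
  simp
  ring

/-- At a double pole two Taylor coefficients of `n` are needed: the equation, divided by `(X -
r)^2`, gives the first by evaluation at `r` and the second by differentiating once. -/
theorem IsShortODE.dvd_veluDefect_of_double {f n d e : F[X]} {A B : F} (h2 : (2 : F) ≠ 0)
    (g : F[X]) (h : IsShortODE f n d A B) {r : F} (hn : n.eval r ≠ 0)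
    (hd : d = (X - C r) ^ 2 * e) (he : e.eval r ≠ 0) :
    (X - C r) ^ 4 ∣ veluDefect f g n d := by
  have ht : (X - C r) ≠ 0 := X_sub_C_ne_zero r
  have h1 : f * (derivative n * (X - C r) * e - 2 * n * e - n * (X - C r) * derivative e) ^ 2 =
      e * (n ^ 3 + C A * n * d ^ 2 + C B * d ^ 3) := by
    apply mul_left_cancel₀ (pow_ne_zero 2 ht)
    unfold IsShortODE at h
    have hd' : derivative d = (X - C r) * (2 * e + (X - C r) * derivative e) := by
      rw [hd, derivative_X_sub_C_pow_mul]
      push_cast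
      ring
    rw [hd', hd] at h
    rw [hd]
    linear_combination h
  have hd0 : d.eval r = 0 := by simp [hd]
  have hd1 : (derivative d).eval r = 0 := by simp [hd, derivative_mul, derivative_pow]
  have e0 : n.eval r = 4 * f.eval r * e.eval r := by
    have h3 := congrArg (eval r) h1
    simp [hd0] at h3
    have : (e.eval r * n.eval r ^ 2) * (n.eval r - 4 * f.eval r * e.eval r) = 0 := by
      linear_combination -h3
    simpa [he, hn, sub_eq_zero] using this
  have e1 : (derivative n).eval r = 2 * (derivative f).eval r * e.eval r
      + 4 * f.eval r * (derivative e).eval r := by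
    have h3 := congrArg (eval r) (congrArg derivative h1)
    simp [hd0, hd1, derivative_mul, derivative_pow] at h3
    have : (2 * e.eval r * n.eval r ^ 2) * ((derivative n).eval r -
      (2 * (derivative f).eval r * e.eval r + 4 * f.eval r * (derivative e).eval r)) = 0 := by
      rw [e0] at h3 ⊢
      linear_combination -h3
    simpa [he, hn, h2, sub_eq_zero] using this
  -- A polynomial with the value and first derivative of `n` at `r`, chosen so that the terms of
  -- `veluDefect` of order 2 and 3 at `r` cancel identically.
  have hZ : (X - C r) ^ 2 ∣ 4 * f * e - 2 * derivative f * (X - C r) * e - n := by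
    apply X_sub_C_sq_dvd
    · simp [e0]
    · simp [derivative_mul, e1]
      ring_nf
  obtain ⟨q, hq⟩ := hZ
  obtain rfl : n = 4 * f * e - 2 * derivative f * (X - C r) * e - (X - C r) ^ 2 * q := by
    rw [← hq]; ring
  refine ⟨g * e ^ 2 - derivative f * derivative e * e
    - 2 * f * (derivative (derivative e) * e - derivative e ^ 2) + q * e, ?_⟩
  have hd' : derivative d = (X - C r) * (2 * e + (X - C r) * derivative e) := by
    rw [hd, derivative_X_sub_C_pow_mul]
    push_cast
    ring
  have hd'' : derivative (derivative d) =
      2 * e + 4 * (X - C r) * derivative e + (X - C r) ^ 2 * derivative (derivative e) := by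
    rw [hd']
    simp only [derivative_mul, derivative_add, derivative_X_sub_C, derivative_ofNat]
    ring
  rw [veluDefect, hd'', hd', hd]
  ring

theorem rootMultiplicity_eq_of_eq_pow_mul {d e : F[X]} {r : F} {m : ℕ}
    (hde : d = (X - C r) ^ m * e) (he : e.eval r ≠ 0) : rootMultiplicity r d = m := by
  have he0 : e ≠ 0 := by
    rintro rfl
    simp at he
  rw [hde, mul_comm, rootMultiplicity_mul_X_sub_C_pow he0, rootMultiplicity_eq_zero he, zero_add]

theorem IsShortODE.rootMultiplicity_eq [DecidableEq F] {f n d : F[X]} {A B : F}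
    (h : IsShortODE f n d A B) (hd0 : d ≠ 0) {r : F} (hn : n.eval r ≠ 0) (hd : d.eval r = 0) :
    rootMultiplicity r d = if f.eval r = 0 then 1 else 2 := by
  rcases h.exists_eq_pow_mul hd0 hn hd with ⟨hf, e, hde, he⟩ | ⟨hf, e, hde, he⟩
  · rw [if_pos hf, rootMultiplicity_eq_of_eq_pow_mul (m := 1) (by rw [pow_one]; exact hde) he]
  · rw [if_neg hf, rootMultiplicity_eq_of_eq_pow_mul hde he]

theorem IsShortODE.sq_dvd_veluDefect [IsAlgClosed F] {f n d : F[X]} {A B : F}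
    (h2 : (2 : F) ≠ 0) (g : F[X]) (h : IsShortODE f n d A B) (hd0 : d ≠ 0)
    (hc : IsCoprime n d) : d ^ 2 ∣ veluDefect f g n d := by
  classical
  by_cases hM : veluDefect f g n d = 0
  · rw [hM]
    exact dvd_zero _
  rw [IsAlgClosed.dvd_iff_roots_le_roots (pow_ne_zero 2 hd0) hM, Multiset.le_iff_count]
  intro r
  rw [roots_pow, Multiset.count_nsmul, count_roots, count_roots]
  by_cases hd : d.eval r = 0
  · have hn : n.eval r ≠ 0 := by
      obtain ⟨a, b, hab⟩ := hc
      intro hn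
      simpa [hn, hd] using congrArg (eval r) hab
    rw [le_rootMultiplicity_iff hM]
    rcases h.exists_eq_pow_mul hd0 hn hd with ⟨hf, e, hde, he⟩ | ⟨hf, e, hde, he⟩
    · rw [rootMultiplicity_eq_of_eq_pow_mul (m := 1) (by rw [pow_one]; exact hde) he]
      exact h.dvd_veluDefect_of_simple g hn hf hde he
    · rw [rootMultiplicity_eq_of_eq_pow_mul hde he]
      exact h.dvd_veluDefect_of_double h2 g hn hde he
  · simp [rootMultiplicity_eq_zero hd]

/-! ### Behaviour at infinity: degree bounds -/

theorem mul_mem_degreeLT {p q : F[X]} {a b c : ℕ} (hp : p.natDegree ≤ a)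
    (hq : q ∈ degreeLT F b) (hc : a + b ≤ c) : p * q ∈ degreeLT F c := by
  rw [mem_degreeLT] at hq ⊢
  by_cases hp0 : p = 0
  · simp [hp0]
  by_cases hq0 : q = 0
  · simp [hq0]
  rw [← natDegree_lt_iff_degree_lt hq0] at hq
  rw [← natDegree_lt_iff_degree_lt (mul_ne_zero hp0 hq0), natDegree_mul hp0 hq0]
  omega

theorem mem_degreeLT_of_natDegree_lt {p : F[X]} {a : ℕ} (hp : p.natDegree < a) :
    p ∈ degreeLT F a :=
  mem_degreeLT.mpr (degree_le_natDegree.trans_lt (by exact_mod_cast hp))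

theorem X_mul_derivative_mem_degreeLT {p : F[X]} {a : ℕ} (hp : p ∈ degreeLT F a) :
    X * derivative p ∈ degreeLT F a := by
  rw [mem_degreeLT, degree_lt_iff_coeff_zero] at hp ⊢
  intro m hm
  cases m with
  | zero => simp
  | succ m => rw [coeff_X_mul, coeff_derivative, hp _ hm, zero_mul]

theorem natDegree_X_mul_derivative_le (p : F[X]) : (X * derivative p).natDegree ≤ p.natDegree := by
  have := X_mul_derivative_mem_degreeLT (p := p) (a := p.natDegree + 1)
    (mem_degreeLT_of_natDegree_lt (Nat.lt_succ_self _))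
  rw [mem_degreeLT] at this
  by_cases h : X * derivative p = 0
  · simp [h]
  · rw [← natDegree_lt_iff_degree_lt h] at this
    omega

/-- The expansion `d' / d = k / x - c / x^2 + O(x^(-3))`, with `k` the degree and `c` the next
coefficient, cleared of denominators; `-c` is the sum of the roots. -/
theorem X_sq_mul_derivative_sub_mem_degreeLT {d : F[X]} (hd : d.Monic) :
    X ^ 2 * derivative d - (C (d.natDegree : F) * X - C d.nextCoeff) * d ∈
      degreeLT F d.natDegree := by
  rw [mem_degreeLT, degree_lt_iff_coeff_zero]
  intro m hm
  rw [sub_mul, mul_assoc, coeff_sub, coeff_sub, coeff_C_mul, coeff_C_mul]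
  by_cases hk : d.natDegree = 0
  · obtain rfl := eq_one_of_monic_natDegree_zero hd hk
    simp [nextCoeff]
  obtain ⟨k, hk⟩ := Nat.exists_eq_succ_of_ne_zero hk
  have hlc : d.coeff (k + 1) = 1 := by
    have := hd.coeff_natDegree
    rwa [hk] at this
  rw [nextCoeff_of_natDegree_pos (by omega), hk, Nat.succ_sub_one]
  rw [hk] at hm
  obtain ⟨j, rfl⟩ := Nat.exists_eq_add_of_le hm
  have hX2 : (X ^ 2 * derivative d).coeff (k.succ + j) = d.coeff (k + j) * ((k + j : ℕ) : F) := by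
    rw [mul_comm]
    cases h : k + j with
    | zero =>
      obtain ⟨rfl, rfl⟩ : k = 0 ∧ j = 0 := by omega
      rw [coeff_mul_X_pow']
      simp
    | succ i =>
      rw [show k.succ + j = i + 2 by omega, coeff_mul_X_pow, coeff_derivative]
      push_cast
      ring
  rw [hX2, show k.succ + j = (k + j) + 1 by lia, coeff_X_mul]
  match j with
  | 0 =>
    rw [add_zero, hlc]
    push_cast
    ring
  | 1 =>
    rw [hlc, coeff_eq_zero_of_natDegree_lt (n := k + 1 + 1) (by omega)]
    push_cast
    ring
  | j + 2 =>
    rw [coeff_eq_zero_of_natDegree_lt (p := d) (n := k + (j + 2)) (by omega),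
      coeff_eq_zero_of_natDegree_lt (n := k + (j + 2) + 1) (by omega)]
    ring

/-- With `σ = -c` and `d' / d = k / x + σ / x^2 + ...`, the terms of order `x` in the defect over
`d^2` are `(k + 1) - 3 k + 2 k - 1 = 0` and the constants are `-σ - 3 σ + 4 σ = 0`. This is what
dictates the linear term `(k + 1) x - σ`. -/
theorem veluDefect_mem_degreeLT {n d s : F[X]} (A B : F) (hd : d.Monic)
    (hs : s ∈ degreeLT F d.natDegree) (hn : n = X * d + s) :
    veluDefect (X ^ 3 + C A * X + C B) (C ((d.natDegree : F) + 1) * X + C d.nextCoeff) n d ∈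
      degreeLT F (2 * d.natDegree) := by
  set k := d.natDegree with hk
  have hp := X_sq_mul_derivative_sub_mem_degreeLT hd
  rw [← hk] at hp
  set c := d.nextCoeff
  set S : F[X] := C (k : F) * X - C c with hS
  set p := X ^ 2 * derivative d - S * d with hpdef
  set f : F[X] := X ^ 3 + C A * X + C B with hf
  have hp' := X_mul_derivative_mem_degreeLT hp
  have hdp : derivative p = 2 * X * derivative d + X ^ 2 * derivative (derivative d)
      - C (k : F) * d - S * derivative d := by
    rw [hpdef, hS]
    simp only [derivative_sub, derivative_mul, derivative_X_pow, derivative_C, derivative_X]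
    simp only [Nat.cast_ofNat, map_ofNat]
    ring
  have hdf : derivative f = 3 * X ^ 2 + C A := by
    rw [hf]
    simp only [derivative_add, derivative_mul, derivative_X_pow, derivative_C, derivative_X]
    simp only [Nat.cast_ofNat, map_ofNat]
    ring
  have hfd : f.natDegree ≤ 3 := by rw [hf]; compute_degree
  have hfd' : (derivative f).natDegree ≤ 2 := by rw [hdf]; compute_degree
  have hSd : S.natDegree ≤ 1 := by rw [hS]; compute_degree
  have hpn : p.natDegree ≤ k := by
    by_cases h : p = 0
    · simp [h]
    · rw [mem_degreeLT, ← natDegree_lt_iff_degree_lt h] at hp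
      exact hp.le
  -- The factor `X ^ 4` lets every derivative of `d` be replaced through `X ^ 2 * derivative d = S *
  -- d + p`, with `p` of degree below `k`. The leading terms then cancel inside the coefficient of
  -- `d ^ 2`.
  have key : X ^ 4 * veluDefect f (C ((k : F) + 1) * X + C c) n d =
      d ^ 2 * (-C A * X ^ 2 * S - 2 * (C A * X + C B) * (C (k : F) * X ^ 2 - 2 * X * S))
      - (X ^ 2 * derivative f * d) * p - (2 * f * X * d) * (X * derivative p)
      + (2 * f * d * (S + 2 * X)) * p + (2 * f * p) * p - (X ^ 4 * d) * s := by
    have e1 : X ^ 2 * derivative d = S * d + p := by rw [hpdef]; ring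
    have e2 : X ^ 4 * derivative (derivative d) = X ^ 2 * derivative p + C (k : F) * X ^ 2 * d
        + (S - 2 * X) * (S * d + p) := by
      rw [hdp, ← e1]
      ring
    have e3 : X ^ 4 * veluDefect f (C ((k : F) + 1) * X + C c) n d =
        X ^ 4 * (C ((k : F) + 1) * X + C c) * d ^ 2
        - X ^ 2 * derivative f * (X ^ 2 * derivative d) * d
        - 2 * f * (X ^ 4 * derivative (derivative d) * d - (X ^ 2 * derivative d) ^ 2)
        - X ^ 4 * n * d := by
      rw [veluDefect]
      ring
    rw [e3, e2, e1, hn, hdf, hf, hS]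
    simp only [map_add, map_one]
    ring
  have hX : X ^ 4 * veluDefect f (C ((k : F) + 1) * X + C c) n d ∈ degreeLT F (2 * k + 4) := by
    rw [key]
    refine sub_mem (add_mem (add_mem (sub_mem (sub_mem ?_ ?_) ?_) ?_) ?_) ?_
    · apply mem_degreeLT_of_natDegree_lt
      refine lt_of_le_of_lt (b := 2 * k + 3) ?_ (by omega)
      refine natDegree_mul_le_of_le (natDegree_pow_le_of_le 2 hk.ge) ?_
      rw [hS]
      compute_degree
    · refine mul_mem_degreeLT (a := 2 + 2 + k) ?_ hp (by omega)
      exact natDegree_mul_le_of_le (natDegree_mul_le_of_le (by compute_degree) hfd') hk.ge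
    · refine mul_mem_degreeLT (a := 0 + 3 + 1 + k) ?_ hp' (by omega)
      exact natDegree_mul_le_of_le (natDegree_mul_le_of_le
        (natDegree_mul_le_of_le (by compute_degree) hfd) (by compute_degree)) hk.ge
    · refine mul_mem_degreeLT (a := 0 + 3 + k + 1) ?_ hp (by omega)
      exact natDegree_mul_le_of_le (natDegree_mul_le_of_le
        (natDegree_mul_le_of_le (by compute_degree) hfd) hk.ge) (by rw [hS]; compute_degree)
    · refine mul_mem_degreeLT (a := 0 + 3 + k) ?_ hp (by omega)
      exact natDegree_mul_le_of_le (natDegree_mul_le_of_le (by compute_degree) hfd) hpn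
    · refine mul_mem_degreeLT (a := 4 + k) ?_ hs (by omega)
      exact natDegree_mul_le_of_le (by compute_degree) hk.ge
  rw [mem_degreeLT, degree_lt_iff_coeff_zero] at hX ⊢
  intro m hm
  have := hX (m + 4) (by omega)
  rwa [mul_comm, coeff_mul_X_pow] at this

/-- Degrees in the equation leave only a simple pole at infinity. Writing `u = a x + b + O(1/x)`,
the cubic and quadratic terms of `f u'^2 = u^3 + ...` give `a^2 = a^3` and `3 a^2 b = 0`. The factor
1 in the normalization is what makes `a = 1`. -/
theorem IsShortODE.exists_eq_X_mul_add {n d : F[X]} {A B A' B' : F} (h3 : (3 : F) ≠ 0)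
    (h : IsShortODE (X ^ 3 + C A * X + C B) n d A' B') (hd : d.Monic)
    (hlt : d.natDegree < n.natDegree) :
    ∃ s ∈ degreeLT F d.natDegree, n = X * d + s := by
  unfold IsShortODE at h
  set f : F[X] := X ^ 3 + C A * X + C B with hf
  have hfd : f.natDegree = 3 := by rw [hf]; compute_degree!
  have hn0 : n ≠ 0 := by rintro rfl; simp at hlt
  have hd0 := hd.ne_zero
  have hN : n.natDegree = d.natDegree + 1 := by
    set w := derivative n * d - n * derivative d with hw
    have hr : (n ^ 3 + C A' * n * d ^ 2 + C B' * d ^ 3).natDegree = 3 * n.natDegree := by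
      rw [add_assoc, natDegree_add_eq_left_of_natDegree_lt, natDegree_pow]
      rw [natDegree_pow]
      refine lt_of_le_of_lt (natDegree_add_le_of_degree_le (n := n.natDegree + 2 * d.natDegree)
        ?_ ?_) (by omega)
      · refine natDegree_mul_le_of_le ((natDegree_C_mul_le _ _)) (natDegree_pow_le)
      · exact (natDegree_C_mul_le _ _).trans (natDegree_pow_le.trans (by omega))
    have hr0 : n ^ 3 + C A' * n * d ^ 2 + C B' * d ^ 3 ≠ 0 := by
      intro h0
      rw [h0] at hr
      simp at hr
      omega
    have hw0 : w ≠ 0 := by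
      intro h0
      rw [h0] at h
      simp [hd0, hr0] at h
    have hfw := congrArg natDegree h
    rw [natDegree_mul (by rintro h0; simp [h0] at hfd) (pow_ne_zero 2 hw0), natDegree_pow,
      natDegree_mul hd0 hr0, hr, hfd] at hfw
    have hwd : w.natDegree ≤ n.natDegree + d.natDegree - 1 := by
      rw [hw]
      refine (natDegree_sub_le_of_le (m := n.natDegree + d.natDegree - 1)
        (n := n.natDegree + d.natDegree - 1) ?_ ?_).trans (max_self _).le
      · exact (natDegree_mul_le_of_le (natDegree_derivative_le n) le_rfl).trans (by omega)
      · by_cases hk : d.natDegree = 0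
        · simp [eq_one_of_monic_natDegree_zero hd hk]
        · exact (natDegree_mul_le_of_le le_rfl (natDegree_derivative_le d)).trans (by omega)
    omega
  set k := d.natDegree with hk
  set s := n %ₘ d with hsdef
  have hs : s ∈ degreeLT F k := by
    rw [mem_degreeLT, hk, ← degree_eq_natDegree hd0]
    exact degree_modByMonic_lt _ hd
  have hqd : (n /ₘ d).natDegree = 1 := by rw [natDegree_divByMonic _ hd]; omega
  obtain ⟨a, b, hq⟩ := exists_eq_X_add_C_of_natDegree_le_one hqd.le
  have ha : a ≠ 0 := by
    rintro rfl
    rw [hq] at hqd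
    simp at hqd
  have hnq : n = (C a * X + C b) * d + s := by
    rw [← hq, hsdef, mul_comm]
    exact (modByMonic_add_div n d).symm.trans (add_comm _ _)
  set q : F[X] := C a * X + C b with hqdef
  have hq1 : q.natDegree ≤ 1 := by rw [hqdef]; compute_degree
  have hsn : s.natDegree ≤ k := by
    by_cases h0 : s = 0
    · simp [h0]
    · rw [mem_degreeLT, ← natDegree_lt_iff_degree_lt h0] at hs
      exact hs.le
  set v := derivative s * d - s * derivative d with hv
  have hXv : X * v ∈ degreeLT F (2 * k) := by
    rw [show X * v = d * (X * derivative s) - (X * derivative d) * s by rw [hv]; ring]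
    refine sub_mem (mul_mem_degreeLT hk.ge (X_mul_derivative_mem_degreeLT hs) (by omega))
      (mul_mem_degreeLT (natDegree_X_mul_derivative_le d) hs (by omega))
  have hXvn : (X * v).natDegree ≤ 2 * k := by
    by_cases h0 : X * v = 0
    · simp [h0]
    · rw [mem_degreeLT, ← natDegree_lt_iff_degree_lt h0] at hXv
      exact hXv.le
  -- That is, `u' = a + (s / d)'`. The correction `v` is controlled through `X * v`, of degree below
  -- `2 k`, which is why the next identity carries a factor `X ^ 2`.
  have hw : derivative n * d - n * derivative d = C a * d ^ 2 + v := by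
    rw [hnq, hv, hqdef]
    simp only [derivative_add, derivative_mul, derivative_C, derivative_X]
    ring
  have key : X ^ 2 * d ^ 4 * (C a ^ 2 * f - q ^ 3) =
      (X ^ 2 * (d * (3 * q ^ 2 * d ^ 2 + 3 * q * d * s + s ^ 2))) * s + X ^ 2 * (C A' * q * d ^ 4)
      + (X ^ 2 * (C A' * d ^ 3)) * s + X ^ 2 * (C B' * d ^ 4) - (2 * C a * f * X * d ^ 2) * (X * v)
      - (f * (X * v)) * (X * v) := by
    rw [hw, hnq] at h
    linear_combination X ^ 2 * h
  have hmem : X ^ 2 * d ^ 4 * (C a ^ 2 * f - q ^ 3) ∈ degreeLT F (4 * k + 4) := by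
    have hdp : ∀ j, (d ^ j).natDegree ≤ j * k := fun j => natDegree_pow_le
    have hX2 : (X ^ 2 : F[X]).natDegree ≤ 2 := by compute_degree
    rw [key]
    refine sub_mem (sub_mem (add_mem (add_mem (add_mem ?_ ?_) ?_) ?_) ?_) ?_
    · refine mul_mem_degreeLT (a := 2 + (k + (2 + 2 * k))) ?_ hs (by omega)
      refine natDegree_mul_le_of_le hX2 (natDegree_mul_le_of_le hk.ge ?_)
      refine natDegree_add_le_of_degree_le (natDegree_add_le_of_degree_le ?_ ?_) ?_
      · exact (natDegree_mul_le_of_le (natDegree_mul_le_of_le (n := 2) (m := 0)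
          (by compute_degree) (natDegree_pow_le_of_le 2 hq1)) (hdp 2)).trans (by omega)
      · exact (natDegree_mul_le_of_le (natDegree_mul_le_of_le (natDegree_mul_le_of_le (m := 0)
          (by compute_degree) hq1) hk.ge) hsn).trans (by omega)
      · exact (natDegree_pow_le_of_le 2 hsn).trans (by omega)
    · apply mem_degreeLT_of_natDegree_lt
      refine lt_of_le_of_lt (natDegree_mul_le_of_le hX2 (natDegree_mul_le_of_le
        (natDegree_mul_le_of_le (m := 0) (by compute_degree) hq1) (hdp 4))) (by omega)
    · refine mul_mem_degreeLT (a := 2 + (0 + 3 * k)) ?_ hs (by omega)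
      exact natDegree_mul_le_of_le hX2 (natDegree_mul_le_of_le (by compute_degree) (hdp 3))
    · apply mem_degreeLT_of_natDegree_lt
      refine lt_of_le_of_lt (natDegree_mul_le_of_le hX2 (natDegree_mul_le_of_le (m := 0)
        (by compute_degree) (hdp 4))) (by omega)
    · refine mul_mem_degreeLT (a := 0 + 3 + 1 + 2 * k) ?_ hXv (by omega)
      exact natDegree_mul_le_of_le (natDegree_mul_le_of_le
        (natDegree_mul_le_of_le (by compute_degree) hfd.le) (by compute_degree)) (hdp 2)
    · refine mul_mem_degreeLT (a := 3 + 2 * k) ?_ hXv (by omega)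
      exact natDegree_mul_le_of_le hfd.le hXvn
  have hg : (C a ^ 2 * f - q ^ 3).degree < 2 := by
    by_cases hg0 : C a ^ 2 * f - q ^ 3 = 0
    · rw [hg0, degree_zero]
      exact WithBot.bot_lt_coe _
    have hX2 : (X ^ 2 : F[X]) ≠ 0 := pow_ne_zero 2 X_ne_zero
    have hd4 := pow_ne_zero 4 hd0
    rw [mem_degreeLT, ← natDegree_lt_iff_degree_lt (mul_ne_zero (mul_ne_zero hX2 hd4) hg0),
      natDegree_mul (mul_ne_zero hX2 hd4) hg0, natDegree_mul hX2 hd4, natDegree_X_pow,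
      natDegree_pow, ← hk] at hmem
    exact (natDegree_lt_iff_degree_lt (n := 2) hg0).mp (by omega)
  have hexp : C a ^ 2 * f - q ^ 3 = C (a ^ 2 - a ^ 3) * X ^ 3 + C (-3 * a ^ 2 * b) * X ^ 2
      + C (a ^ 2 * A - 3 * a * b ^ 2) * X + C (a ^ 2 * B - b ^ 3) := by
    rw [hf, hqdef]
    simp only [map_sub, map_mul, map_pow, map_neg, map_ofNat]
    ring
  have hc := (degree_lt_iff_coeff_zero _ 2).mp hg
  have c3 := hc 3 (by omega)
  have c2 := hc 2 le_rfl
  rw [hexp] at c2 c3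
  simp only [coeff_add, coeff_C_mul, coeff_X_pow, coeff_X, coeff_C] at c2 c3
  norm_num at c2 c3
  have hb : b = 0 := by simpa [h3, ha] using c2
  have ha1 : a = 1 := by
    have : a ^ 2 * (1 - a) = 0 := by linear_combination c3
    have := (mul_eq_zero.mp this).resolve_left (pow_ne_zero 2 ha)
    linear_combination -this
  refine ⟨s, hs, ?_⟩
  rw [hnq, hqdef, hb, ha1]
  simp

/-- The finite poles make the defect a multiple of `d ^ 2`; the expansion at infinity makes its
degree too small for a non-zero multiple. -/
theorem IsShortODE.veluDefect_eq_zero [IsAlgClosed F] {n d : F[X]} {A B A' B' : F}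
    (h2 : (2 : F) ≠ 0) (h3 : (3 : F) ≠ 0)
    (h : IsShortODE (X ^ 3 + C A * X + C B) n d A' B') (hd : d.Monic) (hc : IsCoprime n d)
    (hlt : d.natDegree < n.natDegree) :
    veluDefect (X ^ 3 + C A * X + C B) (C ((d.natDegree : F) + 1) * X + C d.nextCoeff) n d = 0 := by
  obtain ⟨s, hs, hn⟩ := h.exists_eq_X_mul_add h3 hd hlt
  refine eq_zero_of_dvd_of_degree_lt (h.sq_dvd_veluDefect h2 _ hd.ne_zero hc) ?_
  rw [degree_eq_natDegree (pow_ne_zero 2 hd.ne_zero), natDegree_pow, ← mem_degreeLT]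
  exact veluDefect_mem_degreeLT A B hd hs hn

end Polynomial

-- Evaluating rational functions; homogenization

universe u

namespace RatFunc

theorem eval_algebraMap_div {K L : Type u} [Field K] [Field L] (φ : K →+* L) (a : L) (p q : K[X])
    (hq : q.eval₂ φ a ≠ 0) :
    RatFunc.eval φ a (algebraMap K[X] (RatFunc K) p / algebraMap K[X] (RatFunc K) q) =
      p.eval₂ φ a / q.eval₂ φ a := by
  have hq0 : q ≠ 0 := by
    rintro rfl
    simp at hq
  set u : RatFunc K := algebraMap K[X] (RatFunc K) p / algebraMap K[X] (RatFunc K) q with hu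
  have h1 : u.num * q = p * u.denom := (RatFunc.num_mul_eq_mul_denom_iff hq0).mpr hu
  have hd : u.denom.eval₂ φ a ≠ 0 := by
    obtain ⟨c, hc⟩ := RatFunc.denom_div_dvd p q
    intro h0
    apply hq
    rw [hc, eval₂_mul, ← hu, h0, zero_mul]
  rw [RatFunc.eval, div_eq_div_iff hd hq, ← eval₂_mul, ← eval₂_mul, h1]

theorem eval_deriv {K L : Type u} [Field K] [Field L] (φ : K →+* L) (a : L) (u : RatFunc K)
    (hd : u.denom.eval₂ φ a ≠ 0) :
    u.deriv.eval φ a = (derivative u.num * u.denom - u.num * derivative u.denom).eval₂ φ a /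
      u.denom.eval₂ φ a ^ 2 := by
  rw [RatFunc.deriv, ← map_mul, ← map_mul, ← map_sub, ← map_pow, eval_algebraMap_div, eval₂_pow]
  rw [eval₂_pow]
  exact pow_ne_zero 2 hd

end RatFunc

namespace Polynomial

variable {F : Type*} [Field F]

/-- The form of degree `k` attached to `p`, evaluated at `(a, b)`. -/
def homogEval (p : F[X]) (k : ℕ) (a b : F[X]) : F[X] :=
  ∑ i ∈ Finset.range (k + 1), C (p.coeff i) * a ^ i * b ^ (k - i)

theorem eval_homogEval_of_ne_zero {p a b : F[X]} {k : ℕ} (hp : p.natDegree ≤ k) {x : F}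
    (hb : b.eval x ≠ 0) :
    (homogEval p k a b).eval x = b.eval x ^ k * p.eval (a.eval x / b.eval x) := by
  rw [homogEval, eval_finsetSum, eval_eq_sum_range' (Nat.lt_succ_of_le hp), Finset.mul_sum]
  refine Finset.sum_congr rfl fun i hi => ?_
  have hik : i ≤ k := Nat.lt_succ_iff.mp (Finset.mem_range.mp hi)
  simp only [eval_mul, eval_C, eval_pow]
  rw [div_pow]
  field_simp
  rw [mul_assoc, ← pow_add, Nat.sub_add_cancel hik]

/-- This is the value at infinity: it gives sense to `p (a / b)` at a zero of `b`, and is applied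
where the doubled abscissa is infinite. -/
theorem eval_homogEval_of_eq_zero (p a : F[X]) {b : F[X]} (k : ℕ) {x : F}
    (hb : b.eval x = 0) :
    (homogEval p k a b).eval x = p.coeff k * a.eval x ^ k := by
  rw [homogEval, eval_finsetSum, Finset.sum_range_succ, Finset.sum_eq_zero]
  · simp
  · intro i hi
    have : k - i ≠ 0 := by have := Finset.mem_range.mp hi; omega
    simp [hb, this]

end Polynomial

/-! ### Short Weierstrass curves over the algebraic closure, and doubling -/

namespace WeierstrassCurve

namespace Affine

variable {F : Type*} [Field F]

theorem equation_iff_of_isShortNF (W : WeierstrassCurve F) [W.IsShortNF] (x y : F) :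
    W.toAffine.Equation x y ↔ y ^ 2 = x ^ 3 + W.a₄ * x + W.a₆ := by
  rw [Affine.equation_iff]
  simp

theorem Nonsingular.three_mul_sq_add_ne_zero {W : WeierstrassCurve F} [W.IsShortNF] {x : F}
    (h : W.toAffine.Nonsingular x 0) : 3 * x ^ 2 + W.a₄ ≠ 0 := by
  have h' := ((Affine.nonsingular_iff' x 0).mp h).2
  intro h0
  simp at h'
  exact h' (by linear_combination -h0)

theorem Point.exists_add_self_eq [DecidableEq F] {W : WeierstrassCurve F} [W.IsShortNF]
    (h2 : (2 : F) ≠ 0) {x y : F} (h : W.toAffine.Nonsingular x y) (hy : y ≠ 0) :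
    ∃ Y h', (Point.some x y h + Point.some x y h : W.toAffine.Point) =
      Point.some (((3 * x ^ 2 + W.a₄) ^ 2 - 8 * x * (x ^ 3 + W.a₄ * x + W.a₆)) /
        (4 * (x ^ 3 + W.a₄ * x + W.a₆))) Y h' := by
  have heq := (equation_iff_of_isShortNF W x y).mp h.1
  have hyn : y ≠ W.toAffine.negY x y := by
    intro h0
    simp [Affine.negY] at h0
    have : 2 * y = 0 := by linear_combination h0
    simp [h2, hy] at this
  have hX : W.toAffine.addX x x (W.toAffine.slope x x y y) =
      ((3 * x ^ 2 + W.a₄) ^ 2 - 8 * x * (x ^ 3 + W.a₄ * x + W.a₆)) /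
        (4 * (x ^ 3 + W.a₄ * x + W.a₆)) := by
    rw [slope_of_Y_ne rfl hyn, ← heq]
    have h4 : (4 : F) ≠ 0 := by
      rw [show (4 : F) = 2 * 2 by norm_num]
      exact mul_ne_zero h2 h2
    have hyy : y - W.toAffine.negY x y = 2 * y := by
      simp [Affine.negY]
      ring
    rw [hyy, Affine.addX]
    simp
    field_simp
    ring
  rw [Point.add_self_of_Y_ne hyn]
  rw [← hX]
  exact ⟨_, _, rfl⟩

end Affine

instance {K L : Type*} [CommRing K] [CommRing L] [Algebra K L] (E : WeierstrassCurve K)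
    [E.IsShortNF] : (E.baseChange L).IsShortNF where
  a₁ := by simp [baseChange]
  a₂ := by simp [baseChange]
  a₃ := by simp [baseChange]

instance {K L : Type*} [CommRing K] [CommRing L] [Algebra K L] (E : WeierstrassCurve K)
    [E.IsElliptic] : (E.baseChange L).IsElliptic :=
  inferInstanceAs (E.map (algebraMap K L)).IsElliptic

/-- The cubic `x ^ 3 + A x + B` over the algebraic closure. -/
def geomCubic {K : Type*} [Field K] (E : WeierstrassCurve K) : (AlgebraicClosure K)[X] :=
  X ^ 3 + C (algebraMap K (AlgebraicClosure K) E.a₄) * X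
    + C (algebraMap K (AlgebraicClosure K) E.a₆)

section GeomCubic

variable {K : Type*} [Field K] (E : WeierstrassCurve K)

theorem eval_geomCubic (x : AlgebraicClosure K) :
    E.geomCubic.eval x = x ^ 3 + algebraMap K (AlgebraicClosure K) E.a₄ * x
      + algebraMap K (AlgebraicClosure K) E.a₆ := by
  simp [geomCubic]

theorem geomCubic_ne_zero : E.geomCubic ≠ 0 := by
  intro h
  have : E.geomCubic.natDegree = 3 := by rw [geomCubic]; compute_degree!
  simp [h] at this

theorem geomEquation_iff [E.IsShortNF] (x y : AlgebraicClosure K) :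
    (E.baseChange (AlgebraicClosure K)).toAffine.Equation x y ↔ y ^ 2 = E.geomCubic.eval x := by
  rw [Affine.equation_iff_of_isShortNF, eval_geomCubic]
  rfl

theorem geomNonsingular_iff [E.IsElliptic] [E.IsShortNF] (x y : AlgebraicClosure K) :
    (E.baseChange (AlgebraicClosure K)).toAffine.Nonsingular x y ↔
      y ^ 2 = E.geomCubic.eval x := by
  rw [← geomEquation_iff]
  exact (Affine.equation_iff_nonsingular
    (W := (E.baseChange (AlgebraicClosure K)).toAffine)).symm

theorem exists_geomNonsingular [E.IsElliptic] [E.IsShortNF] (x : AlgebraicClosure K) :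
    ∃ y, (E.baseChange (AlgebraicClosure K)).toAffine.Nonsingular x y := by
  obtain ⟨y, hy⟩ := IsAlgClosed.exists_pow_nat_eq (E.geomCubic.eval x) (n := 2) (by norm_num)
  exact ⟨y, (geomNonsingular_iff E x y).mpr hy⟩

theorem eval_derivative_geomCubic_ne_zero [E.IsElliptic] [E.IsShortNF] {x : AlgebraicClosure K}
    (h : E.geomCubic.eval x = 0) :
    3 * x ^ 2 + algebraMap K (AlgebraicClosure K) E.a₄ ≠ 0 :=
  Affine.Nonsingular.three_mul_sq_add_ne_zero
    (W := E.baseChange (AlgebraicClosure K)) ((geomNonsingular_iff E x 0).mpr (by rw [h]; ring))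

end GeomCubic

/-- The numerator of the abscissa of `2 P`. -/
def dblNum {K : Type*} [Field K] (E : WeierstrassCurve K) :
    (AlgebraicClosure K)[X] :=
  (3 * X ^ 2 + C (algebraMap K (AlgebraicClosure K) E.a₄)) ^ 2 - 8 * X * E.geomCubic

theorem exists_add_self_eq {K : Type*} [Field K] {E : WeierstrassCurve K}
    [E.IsElliptic] [E.IsShortNF] (h2 : (2 : K) ≠ 0) {x y : AlgebraicClosure K}
    (h : (E.baseChange (AlgebraicClosure K)).toAffine.Nonsingular x y) (hy : y ≠ 0) :
    open scoped Classical in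
    ∃ Y h', (Affine.Point.some x y h + Affine.Point.some x y h : E.GeomPoint) =
      Affine.Point.some (E.dblNum.eval x / (4 * E.geomCubic).eval x) Y h' := by
  classical
  have h2' : (2 : AlgebraicClosure K) ≠ 0 := by
    rw [← map_ofNat (algebraMap K (AlgebraicClosure K)) 2]
    exact (_root_.map_ne_zero _).mpr h2
  have e := Affine.Point.exists_add_self_eq h2' h hy
  have e1 : E.dblNum.eval x / (4 * E.geomCubic).eval x =
      ((3 * x ^ 2 + (E.baseChange (AlgebraicClosure K)).a₄) ^ 2 - 8 * x *
        (x ^ 3 + (E.baseChange (AlgebraicClosure K)).a₄ * x +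
          (E.baseChange (AlgebraicClosure K)).a₆)) /
        (4 * (x ^ 3 + (E.baseChange (AlgebraicClosure K)).a₄ * x +
          (E.baseChange (AlgebraicClosure K)).a₆)) := by
    simp [dblNum, eval_geomCubic, baseChange]
  rw [e1]
  convert e

/-! ### From the normalized form to the differential equation -/

namespace Isogeny

variable {K : Type*} [Field K] {E E' : WeierstrassCurve K}

/-- Over the algebraic closure, `I (x, y) = (u (x), y u' (x))` with `u = n / d`. -/
def HasGeomForm (I : Isogeny E E') (n d : (AlgebraicClosure K)[X]) : Prop :=
  ∀ (x y : AlgebraicClosure K) (h : (E.baseChange (AlgebraicClosure K)).toAffine.Nonsingular x y),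
    d.eval x ≠ 0 →
    ∃ h', I.toHom (.some x y h) =
      .some (n.eval x / d.eval x)
        (y * ((derivative n * d - n * derivative d).eval x / d.eval x ^ 2)) h'

theorem HasForm.hasGeomForm {I : Isogeny E E'} {u : RatFunc K} (h : I.HasForm u 1) :
    I.HasGeomForm (u.num.map (algebraMap K (AlgebraicClosure K)))
      (u.denom.map (algebraMap K (AlgebraicClosure K))) := by
  intro x y hxy hd
  rw [eval_map] at hd
  obtain ⟨h', hI⟩ := h x y hxy (by rwa [aeval_def])
  have e1 : u.eval (algebraMap K (AlgebraicClosure K)) x =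
      (u.num.map (algebraMap K (AlgebraicClosure K))).eval x /
        (u.denom.map (algebraMap K (AlgebraicClosure K))).eval x := by
    rw [eval_map, eval_map, RatFunc.eval]
  have e2 : algebraMap K (AlgebraicClosure K) 1 * y *
      u.deriv.eval (algebraMap K (AlgebraicClosure K)) x =
      y * ((derivative (u.num.map (algebraMap K (AlgebraicClosure K))) *
        u.denom.map (algebraMap K (AlgebraicClosure K)) -
        u.num.map (algebraMap K (AlgebraicClosure K)) *
        derivative (u.denom.map (algebraMap K (AlgebraicClosure K)))).eval x /
        (u.denom.map (algebraMap K (AlgebraicClosure K))).eval x ^ 2) := by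
    rw [RatFunc.eval_deriv _ _ _ hd, map_one, one_mul, derivative_map, derivative_map,
      ← Polynomial.map_mul, ← Polynomial.map_mul, ← Polynomial.map_sub, eval_map, eval_map]
  rw [← e1, ← e2]
  exact ⟨h', hI⟩

variable [E.IsElliptic] [E'.IsElliptic] [E.IsShortNF] [E'.IsShortNF]
  {I : Isogeny E E'} {n d : (AlgebraicClosure K)[X]}

theorem HasGeomForm.isShortODE (h : I.HasGeomForm n d) (hd : d ≠ 0) :
    IsShortODE E.geomCubic n d (algebraMap K (AlgebraicClosure K) E'.a₄)
      (algebraMap K (AlgebraicClosure K) E'.a₆) := by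
  unfold IsShortODE
  -- The extra factor `d` makes the identity trivial at the roots of `d`, about which the form of
  -- the isogeny says nothing.
  apply mul_left_cancel₀ hd
  refine Polynomial.funext fun x => ?_
  by_cases hx : d.eval x = 0
  · rw [eval_mul, hx, zero_mul, eval_mul, hx, zero_mul]
  obtain ⟨y, hxy⟩ := exists_geomNonsingular E x
  obtain ⟨h', -⟩ := h x y hxy hx
  rw [geomNonsingular_iff, mul_pow, (geomNonsingular_iff E x y).mp hxy, eval_geomCubic E'] at h'
  rw [eval_mul, eval_mul, eval_mul]
  simp only [eval_pow, eval_mul, eval_add, eval_C]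
  set w := (derivative n * d - n * derivative d).eval x with hw
  field_simp at h'
  linear_combination (d.eval x) * h'

end Isogeny

end WeierstrassCurve

/-! ### Compatibility with doubling: the pole at infinity -/

namespace WeierstrassCurve

section GeomCubic

variable {K : Type*} [Field K] (E : WeierstrassCurve K)

theorem exists_geomCubic_eval_eq_zero : ∃ T, E.geomCubic.eval T = 0 := by
  refine IsAlgClosed.exists_root E.geomCubic ?_
  rw [degree_eq_natDegree E.geomCubic_ne_zero,
    show E.geomCubic.natDegree = 3 by rw [geomCubic]; compute_degree!]
  norm_num

theorem eval_dblNum_ne_zero [E.IsElliptic] [E.IsShortNF] {T : AlgebraicClosure K}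
    (hT : E.geomCubic.eval T = 0) : E.dblNum.eval T ≠ 0 := by
  have := pow_ne_zero 2 (eval_derivative_geomCubic_ne_zero E hT)
  rw [dblNum, eval_sub, eval_mul (q := E.geomCubic), hT]
  simpa using this

end GeomCubic

namespace Isogeny

variable {K : Type*} [Field K] {E E' : WeierstrassCurve K}
  [E.IsElliptic] [E'.IsElliptic] [E.IsShortNF] [E'.IsShortNF]
  {I : Isogeny E E'} {n d : (AlgebraicClosure K)[X]}

/-- Compute `I (2 P) = 2 I (P)` in coordinates. As `I (2 P)` is affine by assumption, `I (P)` is not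
2-torsion, so its ordinate `y u'` is non-zero; this gives the first two conclusions. -/
theorem HasGeomForm.duplication (h2 : (2 : K) ≠ 0) (h : I.HasGeomForm n d)
    {x : AlgebraicClosure K} (hf : E.geomCubic.eval x ≠ 0) (hx : d.eval x ≠ 0)
    (hx2 : d.eval (E.dblNum.eval x / (4 * E.geomCubic).eval x) ≠ 0) :
    (derivative n * d - n * derivative d).eval x ≠ 0 ∧
    E'.geomCubic.eval (n.eval x / d.eval x) ≠ 0 ∧
    n.eval (E.dblNum.eval x / (4 * E.geomCubic).eval x) /
      d.eval (E.dblNum.eval x / (4 * E.geomCubic).eval x) =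
    E'.dblNum.eval (n.eval x / d.eval x) / (4 * E'.geomCubic).eval (n.eval x / d.eval x) := by
  classical
  obtain ⟨y, hxy⟩ := exists_geomNonsingular E x
  have hy : y ≠ 0 := by
    rintro rfl
    apply hf
    rw [← (geomNonsingular_iff E x 0).mp hxy]
    ring
  obtain ⟨Y, hY, hadd⟩ := exists_add_self_eq h2 hxy hy
  obtain ⟨h', hI⟩ := h x y hxy hx
  obtain ⟨h'', hI2⟩ := h _ Y hY hx2
  have hsum : I.toHom (.some x y hxy) + I.toHom (.some x y hxy) =
      I.toHom (.some _ Y hY) := by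
    rw [← hadd, map_add]
  rw [hI, hI2] at hsum
  have hw : y * ((derivative n * d - n * derivative d).eval x / d.eval x ^ 2) ≠ 0 := by
    intro h0
    have hneg : y * ((derivative n * d - n * derivative d).eval x / d.eval x ^ 2) =
        (E'.baseChange (AlgebraicClosure K)).toAffine.negY (n.eval x / d.eval x)
          (y * ((derivative n * d - n * derivative d).eval x / d.eval x ^ 2)) := by
      rw [h0]
      simp [Affine.negY]
    rw [Affine.Point.add_self_of_Y_eq hneg] at hsum
    exact Affine.Point.some_ne_zero _ hsum.symm
  obtain ⟨Y', hY', hadd'⟩ := exists_add_self_eq h2 h' hw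
  refine ⟨?_, ?_, ?_⟩
  · intro h0
    rw [h0] at hw
    simp at hw
  · rw [← (geomNonsingular_iff E' _ _).mp h']
    exact pow_ne_zero 2 hw
  · have := hadd'.symm.trans hsum
    exact (Affine.Point.some.inj this).1.symm

/-- Doubling is not constant: at a 2-torsion abscissa only the leading coefficient of `p` survives.
Hence `d` is non-zero at the double of all but finitely many abscissas. -/
theorem homogEval_dblNum_ne_zero (E : WeierstrassCurve K) [E.IsElliptic] [E.IsShortNF]
    {p : (AlgebraicClosure K)[X]} (hp : p ≠ 0) :
    homogEval p p.natDegree E.dblNum (4 * E.geomCubic) ≠ 0 := by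
  obtain ⟨T, hT⟩ := E.exists_geomCubic_eval_eq_zero
  intro h0
  have h := eval_homogEval_of_eq_zero p E.dblNum (b := 4 * E.geomCubic) p.natDegree (x := T)
    (by simp [hT])
  rw [h0, eval_zero, coeff_natDegree] at h
  have ha : E.dblNum.eval T ≠ 0 := E.eval_dblNum_ne_zero hT
  exact mul_ne_zero (leadingCoeff_ne_zero.mpr hp) (pow_ne_zero _ ha) h.symm

omit [E.IsElliptic] [E.IsShortNF] in
theorem eval_four_mul_geomCubic_ne_zero (h2 : (2 : K) ≠ 0) {x : AlgebraicClosure K}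
    (hx : E.geomCubic.eval x ≠ 0) : (4 * E.geomCubic).eval x ≠ 0 := by
  have h4 : (4 : AlgebraicClosure K) ≠ 0 := by
    rw [← map_ofNat (algebraMap K (AlgebraicClosure K)) 4,
      show (OfNat.ofNat 4 : K) = 2 * 2 by norm_num]
    exact (_root_.map_ne_zero _).mpr (mul_ne_zero h2 h2)
  rw [eval_mul]
  exact mul_ne_zero (by simpa using h4) hx

/-- If `u' = 0`, every affine image has ordinate 0 and doubles to `O`; but for a generic `P` the
image of `2 P` is affine. -/
theorem HasGeomForm.wronskian_ne_zero (h2 : (2 : K) ≠ 0) (h : I.HasGeomForm n d) (hd : d ≠ 0) :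
    derivative n * d - n * derivative d ≠ 0 := by
  intro hw
  have hG : E.geomCubic * d * homogEval d d.natDegree E.dblNum (4 * E.geomCubic) ≠ 0 :=
    mul_ne_zero (mul_ne_zero E.geomCubic_ne_zero hd) (homogEval_dblNum_ne_zero E hd)
  apply hG
  refine Polynomial.funext fun x => ?_
  by_contra hx
  rw [eval_zero, eval_mul, eval_mul, mul_eq_zero, mul_eq_zero, not_or, not_or] at hx
  obtain ⟨⟨hf, hdx⟩, hx2⟩ := hx
  rw [eval_homogEval_of_ne_zero le_rfl (eval_four_mul_geomCubic_ne_zero h2 hf)] at hx2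
  exact (h.duplication h2 hf hdx (right_ne_zero_of_mul hx2)).1 (by rw [hw, eval_zero])

/-- Otherwise `u` is finite at infinity. Take a 2-torsion abscissa `T`: its double is at infinity,
so `u` of the double is finite, whereas the differential equation makes the double of `u T`
infinite. The given form does not cover `O`, hence the detour through a polynomial identity. -/
theorem HasGeomForm.natDegree_lt (h2 : (2 : K) ≠ 0) (h : I.HasGeomForm n d) (hd : d ≠ 0)
    (hc : IsCoprime n d) : d.natDegree < n.natDegree := by
  by_contra! hle
  set A' := algebraMap K (AlgebraicClosure K) E'.a₄ with hA'
  set B' := algebraMap K (AlgebraicClosure K) E'.a₆ with hB'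
  set k := d.natDegree with hk
  set c := n ^ 3 + C A' * n * d ^ 2 + C B' * d ^ 3 with hcdef
  have hD2 := homogEval_dblNum_ne_zero E hd
  -- The relation `u (2 P) = (abscissa of 2 I (P))`, cross-multiplied so that it may be evaluated at
  -- `T`. It is checked at generic `x`, after multiplication by a polynomial vanishing at the
  -- exceptions. Both forms use degree `k`, which needs `deg n ≤ k`.
  have hid : homogEval n k E.dblNum (4 * E.geomCubic) * (4 * d * c) =
      homogEval d k E.dblNum (4 * E.geomCubic) *
        ((3 * n ^ 2 + C A' * d ^ 2) ^ 2 - 8 * n * c) := by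
    apply mul_left_cancel₀ (mul_ne_zero (mul_ne_zero E.geomCubic_ne_zero hd) hD2)
    refine Polynomial.funext fun x => ?_
    rw [eval_mul, eval_mul (p := _ * _ * _)]
    by_cases hx : (E.geomCubic * d * homogEval d d.natDegree E.dblNum (4 * E.geomCubic)).eval x = 0
    · rw [hx, zero_mul, zero_mul]
    congr 1
    rw [eval_mul, eval_mul, mul_eq_zero, mul_eq_zero, not_or, not_or] at hx
    obtain ⟨⟨hf, hdx⟩, hx2⟩ := hx
    have hb := eval_four_mul_geomCubic_ne_zero h2 hf
    rw [eval_homogEval_of_ne_zero le_rfl hb] at hx2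
    have hdx2 := right_ne_zero_of_mul hx2
    obtain ⟨-, hF, heq⟩ := h.duplication h2 hf hdx hdx2
    rw [eval_mul, eval_mul (p := homogEval d _ _ _), eval_homogEval_of_ne_zero hle hb,
      eval_homogEval_of_ne_zero hk.ge hb]
    have hFc : E'.geomCubic.eval (n.eval x / d.eval x) = c.eval x / d.eval x ^ 3 := by
      rw [eval_geomCubic, hcdef, ← hA', ← hB']
      simp only [eval_add, eval_mul, eval_pow, eval_C]
      field_simp
    have hc0 : c.eval x ≠ 0 := by
      intro h0
      rw [hFc, h0, zero_div] at hF
      exact hF rfl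
    have hnum : E'.dblNum.eval (n.eval x / d.eval x) =
        ((3 * n ^ 2 + C A' * d ^ 2) ^ 2 - 8 * n * c).eval x / d.eval x ^ 4 := by
      rw [dblNum, eval_sub, eval_mul (q := E'.geomCubic), hFc, ← hA']
      simp only [eval_add, eval_sub, eval_mul, eval_pow, eval_C, eval_X, eval_ofNat]
      field_simp
    have h4F := eval_four_mul_geomCubic_ne_zero (E := E') h2 hF
    rw [div_eq_div_iff hdx2 h4F, hnum, eval_mul (q := E'.geomCubic), hFc] at heq
    generalize E.dblNum.eval x / (4 * E.geomCubic).eval x = t at heq ⊢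
    simp only [eval_mul, eval_ofNat] at heq ⊢
    field_simp at heq
    linear_combination (4 * eval x E.geomCubic) ^ k * heq
  obtain ⟨T, hT⟩ := E.exists_geomCubic_eval_eq_zero
  have hode := congrArg (eval T) (h.isShortODE hd)
  have hidT := congrArg (eval T) hid
  have hb : (4 * E.geomCubic).eval T = 0 := by rw [eval_mul, hT, mul_zero]
  rw [eval_mul, hT, zero_mul, eval_mul, eq_comm] at hode
  rw [eval_mul, eval_mul (p := homogEval d _ _ _), eval_homogEval_of_eq_zero _ _ _ hb, eval_homogEval_of_eq_zero _ _ _ hb,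
    mul_assoc 4 d c, eval_mul (p := 4), eval_mul (p := d)] at hidT
  rw [← hA', ← hB', ← hcdef] at hode
  rw [hode, mul_zero, mul_zero, eq_comm] at hidT
  have hlc := mul_ne_zero (leadingCoeff_ne_zero.mpr hd)
    (pow_ne_zero k (E.eval_dblNum_ne_zero hT))
  have hz := (mul_eq_zero.mp hidT).resolve_left hlc
  have hcop : ¬ (n.eval T = 0 ∧ d.eval T = 0) := by
    rintro ⟨hn0, hd0⟩
    obtain ⟨p, q, hpq⟩ := hc
    simpa [hn0, hd0] using congrArg (eval T) hpq
  -- The doubling numerator vanishes at `T` by `hz`. If `d` vanishes there, this numerator is `n ^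
  -- 4`, against coprimality; if `c` does, `u T` is a singular root of the target cubic.
  rcases mul_eq_zero.mp hode with hd0 | hc0
  · apply hcop
    refine ⟨?_, hd0⟩
    rw [hcdef] at hz
    simp [hd0] at hz
    have : n.eval T ^ 4 = 0 := by linear_combination hz
    exact pow_eq_zero_iff (by norm_num) |>.mp this
  · have hd0 : d.eval T ≠ 0 := by
      intro hd0
      rw [hcdef] at hc0
      simp [hd0] at hc0
      exact hcop ⟨hc0, hd0⟩
    have hF0 : E'.geomCubic.eval (n.eval T / d.eval T) = 0 := by
      rw [hcdef] at hc0
      simp at hc0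
      rw [eval_geomCubic]
      field_simp
      linear_combination hc0
    apply eval_derivative_geomCubic_ne_zero E' hF0
    simp [hc0] at hz
    rw [← hA']
    field_simp
    linear_combination hz

end Isogeny
end WeierstrassCurve

/-! ### Regularity, and the kernel as the zeros of the denominator -/

namespace WeierstrassCurve

section Functions

variable {K : Type*} [Field K] {E : WeierstrassCurve K}

theorem exists_eval_coords_eq (E : WeierstrassCurve K) (G : MvPolynomial (Fin 3) K) :
    ∃ p q : (AlgebraicClosure K)[X], ∀ x y : AlgebraicClosure K, y ^ 2 = E.geomCubic.eval x →
      MvPolynomial.aeval ![x, y, 1] G = p.eval x + q.eval x * y := by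
  induction G using MvPolynomial.induction_on with
  | C a => exact ⟨C (algebraMap _ _ a), 0, fun x y _ => by simp⟩
  | add G H hG hH =>
    obtain ⟨p, q, h⟩ := hG
    obtain ⟨p', q', h'⟩ := hH
    refine ⟨p + p', q + q', fun x y hxy => ?_⟩
    rw [map_add, h x y hxy, h' x y hxy, eval_add, eval_add]
    ring
  | mul_X G i hG =>
    obtain ⟨p, q, h⟩ := hG
    match i with
    | 0 =>
      refine ⟨p * X, q * X, fun x y hxy => ?_⟩
      rw [map_mul, h x y hxy]
      simp
      ring
    | 1 =>
      refine ⟨q * E.geomCubic, p, fun x y hxy => ?_⟩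
      rw [map_mul, h x y hxy, eval_mul, ← hxy]
      simp
      ring
    | 2 =>
      refine ⟨p, q, fun x y hxy => ?_⟩
      rw [map_mul, h x y hxy]
      simp

/-- Use both `y` and `-y`: adding kills the odd part, and dividing by 2 isolates `p`. -/
theorem eq_zero_of_forall_eval_add_eq_zero (h2 : (2 : K) ≠ 0) {p q g : (AlgebraicClosure K)[X]}
    (hg : g ≠ 0) (h : ∀ x y : AlgebraicClosure K, y ^ 2 = E.geomCubic.eval x → g.eval x ≠ 0 →
      p.eval x + q.eval x * y = 0) : p = 0 ∧ q = 0 := by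
  have h2' : (2 : AlgebraicClosure K) ≠ 0 := by
    rw [← map_ofNat (algebraMap K (AlgebraicClosure K)) 2]
    exact (_root_.map_ne_zero _).mpr h2
  have key : ∀ x, g.eval x ≠ 0 → p.eval x = 0 ∧ (E.geomCubic * q).eval x = 0 := by
    intro x hx
    obtain ⟨y, hy⟩ := IsAlgClosed.exists_pow_nat_eq (E.geomCubic.eval x) (n := 2) (by norm_num)
    have e1 := h x y hy hx
    have e2 := h x (-y) (by rw [neg_sq, hy]) hx
    have hp : p.eval x = 0 := by
      have : 2 * p.eval x = 0 := by linear_combination e1 + e2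
      simpa [h2'] using this
    refine ⟨hp, ?_⟩
    rw [eval_mul, ← hy]
    linear_combination y * e1 - y * hp
  constructor
  · apply (mul_eq_zero.mp (?_ : g * p = 0)).resolve_left hg
    refine Polynomial.funext fun x => ?_
    by_cases hx : g.eval x = 0
    · simp [hx]
    · simp [(key x hx).1]
  · apply (mul_eq_zero.mp (?_ : g * E.geomCubic * q = 0)).resolve_left
      (mul_ne_zero hg E.geomCubic_ne_zero)
    refine Polynomial.funext fun x => ?_
    rw [mul_assoc, eval_mul]
    by_cases hx : g.eval x = 0
    · simp [hx]
    · simp only [(key x hx).2, mul_zero, eval_zero]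

end Functions

namespace Isogeny

variable {K : Type*} [Field K] {E E' : WeierstrassCurve K}
  [E.IsElliptic] [E'.IsElliptic] [E.IsShortNF] [E'.IsShortNF]
  {I : Isogeny E E'} {n d : (AlgebraicClosure K)[X]}

omit [E'.IsElliptic] [E'.IsShortNF] in
-- Near the point the map is given by regular `G`. Generically `d G₀ = n G₂`, hence everywhere on
-- the affine curve. At a zero of `d` this forces `G₂ = 0`, which an affine image forbids.
theorem HasGeomForm.apply_eq_zero (h2 : (2 : K) ≠ 0) (h : I.HasGeomForm n d) (hd : d ≠ 0)
    (hc : IsCoprime n d) {x y : AlgebraicClosure K}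
    (hxy : (E.baseChange (AlgebraicClosure K)).toAffine.Nonsingular x y) (hx : d.eval x = 0) :
    I.toHom (.some x y hxy) = 0 := by
  obtain ⟨δ, G, -, ⟨i, hi⟩, hG⟩ := I.regular (.some x y hxy)
  cases hP : I.toHom (.some x y hxy) with
  | zero => rfl
  | some x' y' h' =>
    exfalso
    obtain ⟨c, hcP⟩ := hG (.some x y hxy)
    have hc0 : c ≠ 0 := by
      rintro rfl
      exact hi (by rw [hcP i, zero_mul])
    obtain ⟨p₀, q₀, h₀⟩ := exists_eval_coords_eq E (G 0)
    obtain ⟨p₂, q₂, h₂⟩ := exists_eval_coords_eq E (G 2)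
    obtain ⟨hp, hq⟩ := eq_zero_of_forall_eval_add_eq_zero (E := E) (p := d * p₀ - n * p₂)
      (q := d * q₀ - n * q₂) h2 hd (by
        intro s t hst hs
        have hst' := (geomNonsingular_iff E s t).mpr hst
        obtain ⟨h'', hI⟩ := h s t hst' hs
        obtain ⟨c', hc'⟩ := hG (.some s t hst')
        rw [hI] at hc'
        have e0 := (h₀ s t hst).symm.trans (hc' 0)
        have e2 := (h₂ s t hst).symm.trans (hc' 2)
        simp only [GeomPoint.coords, Matrix.cons_val_zero, Matrix.cons_val, mul_one] at e0 e2
        simp only [eval_sub, eval_mul]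
        rw [← e2] at e0
        field_simp at e0
        linear_combination e0)
    have hst := (geomNonsingular_iff E x y).mp hxy
    have e2 := (h₂ x y hst).symm.trans (hcP 2)
    rw [hP] at e2
    simp only [GeomPoint.coords, Matrix.cons_val, mul_one] at e2
    have hn : n.eval x ≠ 0 := by
      obtain ⟨a, b, hab⟩ := hc
      intro hn
      simpa [hn, hx] using congrArg (eval x) hab
    apply mul_ne_zero hn hc0
    have hp' := congrArg (eval x) hp
    have hq' := congrArg (eval x) hq
    simp only [eval_sub, eval_mul, eval_zero, hx] at hp' hq'
    linear_combination -hp' - y * hq' - n.eval x * e2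

omit [E'.IsElliptic] [E'.IsShortNF] in
theorem HasGeomForm.mem_kernelStar_iff (h2 : (2 : K) ≠ 0) (h : I.HasGeomForm n d) (hd : d ≠ 0)
    (hc : IsCoprime n d) (Q : E.GeomPoint) :
    Q ∈ I.kernelStar ↔ ∃ x y hxy, Q = .some x y hxy ∧ d.eval x = 0 := by
  constructor
  · rintro ⟨hQ, hQ0⟩
    cases Q with
    | zero => exact absurd rfl hQ0
    | some x y hxy =>
      refine ⟨x, y, hxy, rfl, ?_⟩
      by_contra hx
      obtain ⟨h', hI⟩ := h x y hxy hx
      rw [hI] at hQ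
      exact Affine.Point.some_ne_zero _ hQ
  · rintro ⟨x, y, hxy, rfl, hx⟩
    exact ⟨h.apply_eq_zero h2 hd hc hxy hx, Affine.Point.some_ne_zero _⟩

omit [E'.IsElliptic] [E'.IsShortNF] in
theorem HasGeomForm.finite_kernelStar (h2 : (2 : K) ≠ 0) (h : I.HasGeomForm n d) (hd : d ≠ 0)
    (hc : IsCoprime n d) : I.kernelStar.Finite := by
  classical
  let g : AlgebraicClosure K × AlgebraicClosure K → E.GeomPoint := fun P =>
    if hP : (E.baseChange (AlgebraicClosure K)).toAffine.Nonsingular P.1 P.2 then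
      .some P.1 P.2 hP else .zero
  let S : Finset (AlgebraicClosure K × AlgebraicClosure K) := d.roots.toFinset.biUnion fun x =>
    (X ^ 2 - C (E.geomCubic.eval x)).roots.toFinset.image fun y => (x, y)
  refine (S.finite_toSet.image g).subset fun Q hQ => ?_
  obtain ⟨x, y, hxy, rfl, hx⟩ := (h.mem_kernelStar_iff h2 hd hc Q).mp hQ
  refine ⟨(x, y), ?_, dif_pos hxy⟩
  have hy := (geomNonsingular_iff E x y).mp hxy
  have h0 : (X ^ 2 - C (E.geomCubic.eval x) : (AlgebraicClosure K)[X]) ≠ 0 :=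
    X_pow_sub_C_ne_zero (by norm_num) _
  simp [S, hd, hx, h0, hy]

/-- Multiplicities agree because the fibre over `r` is `{(r, y), (r, -y)}`: one point if `f r = 0`,
two otherwise, just as for the order of the pole. -/
theorem HasGeomForm.roots_eq (h2 : (2 : K) ≠ 0) (h : I.HasGeomForm n d) (hd : d ≠ 0)
    (hc : IsCoprime n d) (hfin : I.kernelStar.Finite) :
    d.roots = hfin.toFinset.val.map GeomPoint.abscissa := by
  classical
  have h2' : (2 : AlgebraicClosure K) ≠ 0 := by
    rw [← map_ofNat (algebraMap K (AlgebraicClosure K)) 2]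
    exact (_root_.map_ne_zero _).mpr h2
  ext r
  rw [count_roots, Multiset.count_map, ← Finset.filter_val, Finset.card_val]
  by_cases hr : d.eval r = 0
  · have hn : n.eval r ≠ 0 := by
      obtain ⟨a, b, hab⟩ := hc
      intro hn
      simpa [hn, hr] using congrArg (eval r) hab
    rw [(h.isShortODE hd).rootMultiplicity_eq hd hn hr]
    obtain ⟨y, hy⟩ := exists_geomNonsingular E r
    have hy2 := (geomNonsingular_iff E r y).mp hy
    have hy' := (geomNonsingular_iff E r (-y)).mpr (by rw [neg_sq, hy2])
    have hfil : hfin.toFinset.filter (fun Q => r = Q.abscissa) = {.some r y hy, .some r (-y) hy'} := by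
      ext Q
      rw [Finset.mem_filter, Set.Finite.mem_toFinset, h.mem_kernelStar_iff h2 hd hc,
        Finset.mem_insert, Finset.mem_singleton]
      constructor
      · rintro ⟨⟨x, t, hxt, rfl, -⟩, rfl⟩
        have ht := (geomNonsingular_iff E _ t).mp hxt
        rw [← hy2] at ht
        rcases sq_eq_sq_iff_eq_or_eq_neg.mp ht with rfl | rfl
        · exact Or.inl rfl
        · exact Or.inr rfl
      · rintro (rfl | rfl)
        · exact ⟨⟨_, _, _, rfl, hr⟩, rfl⟩
        · exact ⟨⟨_, _, _, rfl, hr⟩, rfl⟩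
    rw [hfil]
    split_ifs with hf
    · rw [hf] at hy2
      obtain rfl : y = 0 := by simpa using hy2
      simp
    · rw [Finset.card_pair]
      intro he
      have := (Affine.Point.some.inj he).2
      have h0 : 2 * y = 0 := by linear_combination this
      apply hf
      rw [← hy2, (mul_eq_zero.mp h0).resolve_left h2']
      ring
  · rw [rootMultiplicity_eq_zero hr, eq_comm, Finset.card_eq_zero, Finset.filter_eq_empty_iff]
    intro Q hQ hQr
    obtain ⟨x, t, hxt, rfl, hx⟩ :=
      (h.mem_kernelStar_iff h2 hd hc Q).mp ((Set.Finite.mem_toFinset _).mp hQ)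
    exact hr (by rw [hQr]; exact hx)

theorem HasGeomForm.finprod_kernelStar (h2 : (2 : K) ≠ 0) (h : I.HasGeomForm n d) (hd : d.Monic)
    (hc : IsCoprime n d) : d = ∏ᶠ Q ∈ I.kernelStar, (X - C (GeomPoint.abscissa Q)) := by
  have hfin := h.finite_kernelStar h2 hd.ne_zero hc
  rw [finprod_mem_eq_finite_toFinset_prod _ hfin]
  have hs := (IsAlgClosed.splits d).eq_prod_roots_of_monic hd
  rw [h.roots_eq h2 hd.ne_zero hc hfin, Multiset.map_map] at hs
  exact hs

theorem HasGeomForm.finsum_kernelStar (h2 : (2 : K) ≠ 0) (h : I.HasGeomForm n d) (hd : d.Monic)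
    (hc : IsCoprime n d) : ∑ᶠ Q ∈ I.kernelStar, GeomPoint.abscissa Q = -d.nextCoeff := by
  have hfin := h.finite_kernelStar h2 hd.ne_zero hc
  rw [finsum_mem_eq_finite_toFinset_sum _ hfin]
  have hs := (IsAlgClosed.splits d).eq_prod_roots_of_monic hd
  rw [hs, multiset_prod_X_sub_C_nextCoeff, neg_neg, h.roots_eq h2 hd.ne_zero hc hfin]
  rfl

end Isogeny
end WeierstrassCurve

/-! ### Functions on the curve and their values at points -/

namespace WeierstrassCurve

section FunctionField

variable {K : Type*} [Field K]

/-- The coordinate function `x` on `E`. -/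
def xFun (E : WeierstrassCurve K) : E.toAffine.FunctionField :=
  algebraMap E.toAffine.CoordinateRing E.toAffine.FunctionField
    (Affine.CoordinateRing.mk E.toAffine (C X))

/-- The coordinate function `y` on `E`. -/
def yFun (E : WeierstrassCurve K) : E.toAffine.FunctionField :=
  algebraMap E.toAffine.CoordinateRing E.toAffine.FunctionField
    (Affine.CoordinateRing.mk E.toAffine X)

theorem algebraMap_mk_eq_aevalAeval (E : WeierstrassCurve K) (p : K[X][X]) :
    algebraMap E.toAffine.CoordinateRing E.toAffine.FunctionField
      (Affine.CoordinateRing.mk E.toAffine p) = aevalAeval E.xFun E.yFun p := by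
  have key : ((algebraMap E.toAffine.CoordinateRing E.toAffine.FunctionField).comp
      (Affine.CoordinateRing.mk E.toAffine)) =
      (aevalAeval E.xFun E.yFun : K[X][X] →ₐ[K] E.toAffine.FunctionField).toRingHom := by
    refine Polynomial.ringHom_ext' (Polynomial.ringHom_ext' ?_ ?_) ?_
    · ext c
      simp
      rfl
    · simp
      rfl
    · simp
      rfl
  exact congrArg (fun φ => φ p) key

theorem aevalAeval_polynomial {E : WeierstrassCurve K} [E.IsShortNF] {x y : AlgebraicClosure K}
    (h : y ^ 2 = E.geomCubic.eval x) : aevalAeval x y E.toAffine.polynomial = 0 := by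
  rw [eval_geomCubic] at h
  rw [Affine.polynomial]
  simp
  linear_combination h

theorem aevalAeval_eq_of_mk_eq {E : WeierstrassCurve K} [E.IsShortNF] {x y : AlgebraicClosure K}
    (h : y ^ 2 = E.geomCubic.eval x) {p q : K[X][X]}
    (hpq : Affine.CoordinateRing.mk E.toAffine p = Affine.CoordinateRing.mk E.toAffine q) :
    aevalAeval x y p = aevalAeval x y q := by
  obtain ⟨r, hr⟩ := AdjoinRoot.mk_eq_mk.mp hpq
  have := congrArg (aevalAeval x y) hr
  rw [map_mul, aevalAeval_polynomial h, zero_mul, map_sub] at this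
  exact sub_eq_zero.mp this

theorem exists_mk_eq_mk_C_add (E : WeierstrassCurve K) (p : K[X][X]) :
    ∃ a b : K[X], Affine.CoordinateRing.mk E.toAffine p =
      Affine.CoordinateRing.mk E.toAffine (C a + C b * X) := by
  obtain ⟨a, b, h⟩ := Affine.CoordinateRing.exists_smul_basis_eq
    (Affine.CoordinateRing.mk E.toAffine p)
  refine ⟨a, b, ?_⟩
  rw [← h, Affine.CoordinateRing.smul, Affine.CoordinateRing.smul, mul_one, map_add, map_mul]

/-- Take the norm to `K[x]`: reduce `q` to `a + b y` on the curve and use `a^2 - f b^2`. It confines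
the zeros of `q` to finitely many abscissas. -/
theorem exists_norm (E : WeierstrassCurve K) [E.IsShortNF] {q : K[X][X]}
    (hq : Affine.CoordinateRing.mk E.toAffine q ≠ 0) :
    ∃ N : K[X], N ≠ 0 ∧ ∀ x y : AlgebraicClosure K, y ^ 2 = E.geomCubic.eval x →
      aevalAeval x y q = 0 → aeval x N = 0 := by
  obtain ⟨a, b, hab⟩ := exists_mk_eq_mk_C_add E q
  refine ⟨a ^ 2 - (X ^ 3 + C E.a₄ * X + C E.a₆) * b ^ 2, ?_, ?_⟩
  · intro h0
    have hmul : Affine.CoordinateRing.mk E.toAffine (C a + C b * X) *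
        Affine.CoordinateRing.mk E.toAffine (C a - C b * X) = 0 := by
      rw [← map_mul, ← map_zero (Affine.CoordinateRing.mk E.toAffine), AdjoinRoot.mk_eq_mk]
      refine ⟨-C b ^ 2, ?_⟩
      have h1 := congrArg (C : K[X] → K[X][X]) h0
      rw [Affine.polynomial]
      simp at h1 ⊢
      linear_combination h1
    rw [hab] at hq
    have h1 := (mul_eq_zero.mp hmul).resolve_left hq
    have h2 := Affine.CoordinateRing.smul_basis_eq_zero (W' := E.toAffine) (p := a) (q := -b) (by
      rw [Affine.CoordinateRing.smul, Affine.CoordinateRing.smul, mul_one, ← map_mul, ← map_add,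
        ← h1]
      congr 1
      simp
      ring)
    apply hq
    rw [h2.1, neg_eq_zero.mp h2.2]
    simp
  · intro x y hxy h0
    rw [aevalAeval_eq_of_mk_eq hxy hab] at h0
    rw [eval_geomCubic] at hxy
    simp at h0 ⊢
    linear_combination (aeval x a - aeval x b * y) * h0 + (aeval x b) ^ 2 * hxy

end FunctionField

section HasValueAt

variable {K : Type*} [Field K] {E : WeierstrassCurve K}

theorem hasValueAt_iff {f : E.toAffine.FunctionField} {x y z : AlgebraicClosure K} :
    HasValueAt f x y z ↔ ∃ p q : K[X][X], aevalAeval E.xFun E.yFun q * f =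
      aevalAeval E.xFun E.yFun p ∧ aevalAeval x y q ≠ 0 ∧
      z = aevalAeval x y p / aevalAeval x y q := by
  simp only [HasValueAt, algebraMap_mk_eq_aevalAeval]

variable {f g : E.toAffine.FunctionField} {x y a b : AlgebraicClosure K}

theorem hasValueAt_aevalAeval (p : K[X][X]) (x y : AlgebraicClosure K) :
    HasValueAt (aevalAeval E.xFun E.yFun p) x y (aevalAeval x y p) :=
  hasValueAt_iff.mpr ⟨p, 1, by rw [map_one, one_mul], by rw [map_one]; exact one_ne_zero,
    by rw [map_one, div_one]⟩

theorem hasValueAt_xFun (x y : AlgebraicClosure K) : HasValueAt E.xFun x y x := by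
  simpa using hasValueAt_aevalAeval (E := E) (C X) x y

theorem hasValueAt_yFun (x y : AlgebraicClosure K) : HasValueAt E.yFun x y y := by
  simpa using hasValueAt_aevalAeval (E := E) X x y

theorem hasValueAt_algebraMap (c : K) (x y : AlgebraicClosure K) :
    HasValueAt (algebraMap K E.toAffine.FunctionField c) x y (algebraMap K _ c) := by
  simpa using hasValueAt_aevalAeval (E := E) (C (C c)) x y

theorem HasValueAt.add (hf : HasValueAt f x y a) (hg : HasValueAt g x y b) :
    HasValueAt (f + g) x y (a + b) := by
  rw [hasValueAt_iff] at hf hg ⊢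
  obtain ⟨p, q, h1, h2, rfl⟩ := hf
  obtain ⟨p', q', h1', h2', rfl⟩ := hg
  refine ⟨p * q' + p' * q, q * q', ?_, ?_, ?_⟩
  · simp only [map_add, map_mul]
    linear_combination aevalAeval E.xFun E.yFun q' * h1 + aevalAeval E.xFun E.yFun q * h1'
  · rw [map_mul]
    exact mul_ne_zero h2 h2'
  · simp only [map_add, map_mul]
    field_simp

theorem HasValueAt.mul (hf : HasValueAt f x y a) (hg : HasValueAt g x y b) :
    HasValueAt (f * g) x y (a * b) := by
  rw [hasValueAt_iff] at hf hg ⊢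
  obtain ⟨p, q, h1, h2, rfl⟩ := hf
  obtain ⟨p', q', h1', h2', rfl⟩ := hg
  refine ⟨p * p', q * q', ?_, ?_, ?_⟩
  · simp only [map_mul]
    rw [← h1, ← h1']
    ring
  · rw [map_mul]
    exact mul_ne_zero h2 h2'
  · simp only [map_mul]
    field_simp

theorem HasValueAt.sub (hf : HasValueAt f x y a) (hg : HasValueAt g x y b) :
    HasValueAt (f - g) x y (a - b) := by
  have := hf.add ((hasValueAt_algebraMap (-1) x y).mul hg)
  simpa [sub_eq_add_neg] using this

theorem HasValueAt.pow (hf : HasValueAt f x y a) (k : ℕ) : HasValueAt (f ^ k) x y (a ^ k) := by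
  induction k with
  | zero => simpa using hasValueAt_algebraMap (E := E) 1 x y
  | succ k ih =>
    rw [pow_succ, pow_succ]
    exact ih.mul hf

theorem HasValueAt.aeval (hf : HasValueAt f x y a) (p : K[X]) :
    HasValueAt (Polynomial.aeval f p) x y (Polynomial.aeval a p) := by
  induction p using Polynomial.induction_on' with
  | add p q hp hq =>
    rw [map_add, map_add]
    exact hp.add hq
  | monomial k c =>
    rw [aeval_monomial, aeval_monomial]
    exact (hasValueAt_algebraMap c x y).mul (hf.pow k)

theorem HasValueAt.aevalAeval (hf : HasValueAt f x y a) (hg : HasValueAt g x y b) (p : K[X][X]) :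
    HasValueAt (Polynomial.aevalAeval f g p) x y (Polynomial.aevalAeval a b p) := by
  induction p using Polynomial.induction_on' with
  | add p q hp hq =>
    rw [map_add, map_add]
    exact hp.add hq
  | monomial k c =>
    rw [← C_mul_X_pow_eq_monomial, map_mul, map_mul, map_pow, map_pow, aevalAeval_C, aevalAeval_C,
      aevalAeval_Y, aevalAeval_Y]
    exact (hf.aeval c).mul (hg.pow k)

theorem HasValueAt.unique [E.IsShortNF] (hxy : y ^ 2 = E.geomCubic.eval x)
    (hf : HasValueAt f x y a) (hg : HasValueAt f x y b) : a = b := by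
  rw [hasValueAt_iff] at hf hg
  obtain ⟨p, q, h1, h2, rfl⟩ := hf
  obtain ⟨p', q', h1', h2', rfl⟩ := hg
  have h : Polynomial.aevalAeval E.xFun E.yFun (p * q') = Polynomial.aevalAeval E.xFun E.yFun (p' * q) := by
    rw [map_mul, map_mul, ← h1, ← h1']
    ring
  rw [← algebraMap_mk_eq_aevalAeval, ← algebraMap_mk_eq_aevalAeval] at h
  have h3 := aevalAeval_eq_of_mk_eq hxy (IsFractionRing.injective _ _ h)
  rw [map_mul, map_mul] at h3
  rw [div_eq_div_iff h2 h2', h3]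

theorem exists_aevalAeval_mul_eq (f : E.toAffine.FunctionField) :
    ∃ p q : K[X][X], Affine.CoordinateRing.mk E.toAffine q ≠ 0 ∧
      aevalAeval E.xFun E.yFun q * f = aevalAeval E.xFun E.yFun p := by
  obtain ⟨r, s, hs, rfl⟩ := IsFractionRing.div_surjective (A := E.toAffine.CoordinateRing) f
  obtain ⟨p, rfl⟩ := AdjoinRoot.mk_surjective r
  obtain ⟨q, rfl⟩ := AdjoinRoot.mk_surjective s
  have hq := nonZeroDivisors.ne_zero hs
  refine ⟨p, q, hq, ?_⟩
  rw [← algebraMap_mk_eq_aevalAeval, ← algebraMap_mk_eq_aevalAeval]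
  have : algebraMap E.toAffine.CoordinateRing E.toAffine.FunctionField
      (Affine.CoordinateRing.mk E.toAffine q) ≠ 0 :=
    (map_ne_zero_iff _ (IsFractionRing.injective _ _)).mpr hq
  exact mul_div_cancel₀ _ this

theorem exists_hasValueAt [E.IsShortNF] (f : E.toAffine.FunctionField) :
    ∃ g : (AlgebraicClosure K)[X], g ≠ 0 ∧ ∀ x y, y ^ 2 = E.geomCubic.eval x → g.eval x ≠ 0 →
      ∃ z, HasValueAt f x y z := by
  obtain ⟨p, q, hq, h⟩ := exists_aevalAeval_mul_eq f
  obtain ⟨N, hN, hN'⟩ := exists_norm E hq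
  refine ⟨N.map (algebraMap K _), (Polynomial.map_ne_zero_iff (algebraMap K _).injective).mpr hN,
    fun x y hxy hx => ⟨_, hasValueAt_iff.mpr ⟨p, q, h, fun h0 => hx ?_, rfl⟩⟩⟩
  rw [eval_map_algebraMap]
  exact hN' x y hxy h0

/-- The tool by which identities in the function field are proved pointwise, off finitely many
abscissas. -/
theorem eq_zero_of_forall_hasValueAt_zero [E.IsShortNF] (h2 : (2 : K) ≠ 0)
    {f : E.toAffine.FunctionField} {g : (AlgebraicClosure K)[X]} (hg : g ≠ 0)
    (h : ∀ x y, y ^ 2 = E.geomCubic.eval x → g.eval x ≠ 0 → HasValueAt f x y 0) : f = 0 := by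
  obtain ⟨p, q, hq, hf⟩ := exists_aevalAeval_mul_eq f
  obtain ⟨a, b, hab⟩ := exists_mk_eq_mk_C_add E p
  have hz := eq_zero_of_forall_eval_add_eq_zero (E := E) h2 (g := g)
    (p := a.map (algebraMap K _)) (q := b.map (algebraMap K _)) hg (by
      intro x y hxy hx
      have h1 := (hasValueAt_aevalAeval (E := E) q x y).mul (h x y hxy hx)
      rw [hf, mul_zero] at h1
      have h3 := h1.unique hxy (hasValueAt_aevalAeval (E := E) p x y)
      rw [aevalAeval_eq_of_mk_eq hxy hab] at h3
      rw [eval_map_algebraMap, eval_map_algebraMap, h3]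
      simp)
  rw [Polynomial.map_eq_zero, Polynomial.map_eq_zero] at hz
  rw [← algebraMap_mk_eq_aevalAeval, ← algebraMap_mk_eq_aevalAeval, hab, hz.1, hz.2] at hf
  have hq' : algebraMap E.toAffine.CoordinateRing E.toAffine.FunctionField
      (Affine.CoordinateRing.mk E.toAffine q) ≠ 0 :=
    (map_ne_zero_iff _ (IsFractionRing.injective _ _)).mpr hq
  simpa [hq'] using hf

end HasValueAt

end WeierstrassCurve

/-! ### Degrees of `K(E)` over `K(x)` and over `K(u, y t)` -/

theorem IntermediateField.relfinrank_sup_adjoin_of_sq_mem {K M : Type*} [Field K] [Field M]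
    [Algebra K M] (A : IntermediateField K M) {v : M} (hv : v ∉ A) (hv2 : v ^ 2 ∈ A) :
    IntermediateField.relfinrank A (A ⊔ IntermediateField.adjoin K {v}) = 2 := by
  have hroot : aeval v (X ^ 2 - C (⟨v ^ 2, hv2⟩ : A)) = 0 := by
    simp [IntermediateField.algebraMap_apply]
  have hmonic : (X ^ 2 - C (⟨v ^ 2, hv2⟩ : A)).Monic := monic_X_pow_sub_C _ (by norm_num)
  have hint : IsIntegral A v := ⟨_, hmonic, hroot⟩
  rw [IntermediateField.relfinrank_eq_finrank_of_le le_sup_left]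
  have hext : IntermediateField.extendScalars (le_sup_left : A ≤ A ⊔ IntermediateField.adjoin K {v})
      = IntermediateField.adjoin A {v} := by
    apply IntermediateField.restrictScalars_injective K
    rw [IntermediateField.extendScalars_restrictScalars,
      IntermediateField.restrictScalars_adjoin_eq_sup]
  rw [hext, IntermediateField.adjoin.finrank hint]
  apply le_antisymm
  · have := natDegree_le_of_dvd (minpoly.dvd A v hroot) hmonic.ne_zero
    rwa [natDegree_X_pow_sub_C] at this
  · rw [minpoly.two_le_natDegree_iff hint]
    rintro ⟨a, ha⟩
    exact hv (ha ▸ a.2)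

theorem IntermediateField.aeval_mem {K M : Type*} [Field K] [Field M] [Algebra K M]
    (A : IntermediateField K M) {v : M} (hv : v ∈ A) (p : K[X]) : aeval v p ∈ A := by
  induction p using Polynomial.induction_on' with
  | add p q hp hq =>
    rw [map_add]
    exact add_mem hp hq
  | monomial k c =>
    rw [aeval_monomial]
    exact mul_mem (A.algebraMap_mem c) (pow_mem hv k)

namespace WeierstrassCurve

section FunctionField

variable {K : Type*} [Field K] {E : WeierstrassCurve K} [E.IsShortNF]

theorem aeval_xFun_injective (h2 : (2 : K) ≠ 0) :
    Function.Injective (aeval E.xFun : K[X] →ₐ[K] E.toAffine.FunctionField) := by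
  rw [injective_iff_map_eq_zero]
  intro p hp
  have := (eq_zero_of_forall_eval_add_eq_zero (E := E) h2 (p := p.map (algebraMap K _)) (q := 0)
    one_ne_zero (by
      intro x y hxy _
      have h := (hasValueAt_xFun (E := E) x y).aeval p
      rw [hp] at h
      rw [eval_map_algebraMap, h.unique hxy (by simpa using hasValueAt_algebraMap (E := E) 0 x y)]
      simp)).1
  rwa [Polynomial.map_eq_zero] at this

/-- The embedding of `K(x)` into the function field of `E`. -/
def ratFuncHom (E : WeierstrassCurve K) [E.IsShortNF] (h2 : (2 : K) ≠ 0) :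
    RatFunc K →ₐ[K] E.toAffine.FunctionField :=
  RatFunc.liftAlgHom (aeval E.xFun)
    (nonZeroDivisors_le_comap_nonZeroDivisors_of_injective _ (aeval_xFun_injective h2))

theorem ratFuncHom_div (h2 : (2 : K) ≠ 0) (p q : K[X]) :
    E.ratFuncHom h2 (algebraMap K[X] (RatFunc K) p / algebraMap K[X] (RatFunc K) q) =
      aeval E.xFun p / aeval E.xFun q :=
  RatFunc.liftAlgHom_apply_div _ _ _ _

theorem hasValueAt_ratFuncHom_div (h2 : (2 : K) ≠ 0) (p q : K[X]) {x y : AlgebraicClosure K}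
    (hq : aeval x q ≠ 0) :
    HasValueAt (E.ratFuncHom h2 (algebraMap K[X] (RatFunc K) p / algebraMap K[X] (RatFunc K) q))
      x y (aeval x p / aeval x q) := by
  rw [hasValueAt_iff, ratFuncHom_div]
  have hq0 : aeval E.xFun q ≠ 0 := by
    rw [Ne, map_eq_zero_iff _ (aeval_xFun_injective h2)]
    rintro rfl
    simp at hq
  refine ⟨C p, C q, ?_, ?_, ?_⟩
  · rw [aevalAeval_C, aevalAeval_C, mul_div_cancel₀ _ hq0]
  · rwa [aevalAeval_C]
  · rw [aevalAeval_C, aevalAeval_C]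

theorem yFun_notMem_fieldRange (h2 : (2 : K) ≠ 0) : E.yFun ∉ (E.ratFuncHom h2).fieldRange := by
  rintro ⟨r, hr⟩
  change E.ratFuncHom h2 r = E.yFun at hr
  have hd0 : r.denom.map (algebraMap K (AlgebraicClosure K)) ≠ 0 :=
    (Polynomial.map_ne_zero_iff (algebraMap K _).injective).mpr r.denom_ne_zero
  have := (eq_zero_of_forall_eval_add_eq_zero (E := E) h2
    (p := r.num.map (algebraMap K (AlgebraicClosure K)))
    (q := -r.denom.map (algebraMap K (AlgebraicClosure K))) hd0 (by
      intro x y hxy hx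
      rw [eval_map_algebraMap] at hx
      have h := hasValueAt_ratFuncHom_div (E := E) h2 r.num r.denom (y := y) hx
      rw [RatFunc.num_div_denom, hr] at h
      have hy := (hasValueAt_yFun (E := E) x y).unique hxy h
      rw [eval_neg, eval_map_algebraMap, eval_map_algebraMap, hy]
      field_simp
      ring)).2
  exact hd0 (neg_eq_zero.mp this)

theorem yFun_sq (h2 : (2 : K) ≠ 0) :
    E.yFun ^ 2 = aeval E.xFun (X ^ 3 + C E.a₄ * X + C E.a₆) := by
  rw [← sub_eq_zero]
  refine eq_zero_of_forall_hasValueAt_zero h2 one_ne_zero fun x y hxy _ => ?_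
  have h := ((hasValueAt_yFun (E := E) x y).pow 2).sub
    ((hasValueAt_xFun (E := E) x y).aeval (X ^ 3 + C E.a₄ * X + C E.a₆))
  convert h using 1
  rw [hxy, eval_geomCubic]
  simp

theorem aeval_xFun_mem_fieldRange (h2 : (2 : K) ≠ 0) (p : K[X]) :
    aeval E.xFun p ∈ (E.ratFuncHom h2).fieldRange :=
  ⟨algebraMap K[X] (RatFunc K) p / algebraMap K[X] (RatFunc K) 1, by
    change E.ratFuncHom h2 _ = _
    rw [ratFuncHom_div, map_one, div_one]⟩

theorem fieldRange_sup_adjoin_yFun (h2 : (2 : K) ≠ 0) :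
    (E.ratFuncHom h2).fieldRange ⊔ IntermediateField.adjoin K {E.yFun} = ⊤ := by
  rw [eq_top_iff]
  intro f _
  set T := (E.ratFuncHom h2).fieldRange ⊔ IntermediateField.adjoin K {E.yFun} with hT
  have hx : ∀ p : K[X], aeval E.xFun p ∈ T := fun p =>
    (le_sup_left : (E.ratFuncHom h2).fieldRange ≤ T) (aeval_xFun_mem_fieldRange h2 p)
  have hy : E.yFun ∈ T :=
    (le_sup_right : IntermediateField.adjoin K {E.yFun} ≤ T)
      (IntermediateField.mem_adjoin_simple_self K _)
  have hmem : ∀ p : K[X][X], aevalAeval E.xFun E.yFun p ∈ T := by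
    intro p
    induction p using Polynomial.induction_on' with
    | add p q hp hq =>
      rw [map_add]
      exact add_mem hp hq
    | monomial k c =>
      rw [← C_mul_X_pow_eq_monomial, map_mul, map_pow, aevalAeval_C, aevalAeval_Y]
      exact mul_mem (hx c) (pow_mem hy k)
  obtain ⟨p, q, hq, h⟩ := exists_aevalAeval_mul_eq f
  have hq' : aevalAeval E.xFun E.yFun q ≠ 0 := by
    rw [← algebraMap_mk_eq_aevalAeval]
    exact (map_ne_zero_iff _ (IsFractionRing.injective _ _)).mpr hq
  rw [eq_div_of_mul_eq hq' ((mul_comm _ _).trans h)]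
  exact div_mem (hmem p) (hmem q)

theorem finrank_fieldRange (h2 : (2 : K) ≠ 0) :
    Module.finrank (E.ratFuncHom h2).fieldRange E.toAffine.FunctionField = 2 := by
  rw [← IntermediateField.relfinrank_top_right, ← fieldRange_sup_adjoin_yFun h2]
  refine IntermediateField.relfinrank_sup_adjoin_of_sq_mem _ (yFun_notMem_fieldRange h2) ?_
  rw [yFun_sq h2]
  exact aeval_xFun_mem_fieldRange h2 _

/-- `[K(E) : K(u, y t)]` is the degree of the rational function `u`, if `(y t) ^ 2 ∈ K(u)`. -/
theorem finrank_adjoin_pair (h2 : (2 : K) ≠ 0) {u t : RatFunc K} (ht : t ≠ 0)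
    (hsq : (E.yFun * E.ratFuncHom h2 t) ^ 2 ∈
      IntermediateField.adjoin K {E.ratFuncHom h2 u}) :
    Module.finrank (IntermediateField.adjoin K {E.ratFuncHom h2 u, E.yFun * E.ratFuncHom h2 t})
      E.toAffine.FunctionField = max u.num.natDegree u.denom.natDegree := by
  set j := E.ratFuncHom h2 with hj
  set v := E.yFun * j t with hv
  set G := IntermediateField.adjoin K {j u} with hG
  have hGmap : G = (IntermediateField.adjoin K {u}).map j := by
    rw [IntermediateField.adjoin_map, Set.image_singleton]
  have hGle : G ≤ j.fieldRange := by
    rw [hGmap, AlgHom.fieldRange_eq_map]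
    exact IntermediateField.map_mono _ le_top
  have hvG : v ∉ G := by
    intro hmem
    have h1 := hGle hmem
    apply yFun_notMem_fieldRange (E := E) h2
    rw [← hj]
    have ht0 : j t ≠ 0 := (_root_.map_ne_zero j).mpr ht
    rw [show E.yFun = v / j t by rw [hv, mul_div_cancel_right₀ _ ht0]]
    exact div_mem h1 ⟨t, rfl⟩
  have hL : IntermediateField.adjoin K {j u, v} = G ⊔ IntermediateField.adjoin K {v} := by
    rw [hG, ← IntermediateField.adjoin_union, Set.singleton_union]
  -- Compute `[K(E) : K(u)]` along two towers, through `K(x)` and through `K(u, v)`. Each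
  -- contributes a quadratic step, and the factors 2 cancel.
  have e1 := IntermediateField.relfinrank_mul_finrank_top hGle
  have e2 := IntermediateField.relfinrank_mul_finrank_top
    (le_sup_left : G ≤ G ⊔ IntermediateField.adjoin K {v})
  rw [IntermediateField.relfinrank_sup_adjoin_of_sq_mem G hvG hsq, ← e1, hj,
    finrank_fieldRange h2, ← hj] at e2
  rw [hL]
  have e3 : IntermediateField.relfinrank G j.fieldRange =
      max u.num.natDegree u.denom.natDegree := by
    rw [hGmap, AlgHom.fieldRange_eq_map, IntermediateField.relfinrank_map_map,
      IntermediateField.relfinrank_top_right, RatFunc.finrank_eq_max_natDegree]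
  rw [e3] at e2
  omega

end FunctionField

end WeierstrassCurve

/-! ### The pullback field and the degree of the isogeny -/

namespace WeierstrassCurve
namespace Isogeny

variable {K : Type*} [Field K] {E E' : WeierstrassCurve K}
  [E.IsElliptic] [E'.IsElliptic] [E.IsShortNF] [E'.IsShortNF]
  {I : Isogeny E E'} {u : RatFunc K}

/-- The derivative of `u` as a fraction of polynomials. -/
def derivFrac (u : RatFunc K) : RatFunc K :=
  algebraMap K[X] (RatFunc K) (derivative u.num * u.denom - u.num * derivative u.denom) /
    algebraMap K[X] (RatFunc K) (u.denom ^ 2)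

omit [E.IsElliptic] [E'.IsElliptic] [E'.IsShortNF] in
/-- The coordinates of `I (x, y)` are the values of the functions `u` and `y u'` on `E`. -/
theorem HasForm.exists_hasValueAt (h2 : (2 : K) ≠ 0) (h : I.HasForm u 1)
    {x y : AlgebraicClosure K}
    (hxy : (E.baseChange (AlgebraicClosure K)).toAffine.Nonsingular x y)
    (hx : (u.denom.map (algebraMap K (AlgebraicClosure K))).eval x ≠ 0) :
    ∃ x' y' h', I.toHom (.some x y hxy) = .some x' y' h' ∧
      HasValueAt (E.ratFuncHom h2 u) x y x' ∧
      HasValueAt (E.yFun * E.ratFuncHom h2 (derivFrac u)) x y y' := by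
  obtain ⟨h', hI⟩ := h.hasGeomForm x y hxy hx
  refine ⟨_, _, h', hI, ?_, ?_⟩
  · rw [eval_map_algebraMap] at hx
    have := hasValueAt_ratFuncHom_div (E := E) h2 u.num u.denom (y := y) hx
    rw [RatFunc.num_div_denom] at this
    rwa [eval_map_algebraMap, eval_map_algebraMap]
  · rw [eval_map_algebraMap] at hx
    refine (hasValueAt_yFun x y).mul ?_
    have := hasValueAt_ratFuncHom_div (E := E) h2
      (derivative u.num * u.denom - u.num * derivative u.denom) (u.denom ^ 2) (x := x) (y := y)
      (by rw [map_pow]; exact pow_ne_zero 2 hx)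
    convert this using 1
    · rfl
    rw [derivative_map, derivative_map, ← Polynomial.map_mul, ← Polynomial.map_mul,
      ← Polynomial.map_sub, eval_map_algebraMap, eval_map_algebraMap, map_pow]

theorem denom_map_ne_zero (u : RatFunc K) :
    u.denom.map (algebraMap K (AlgebraicClosure K)) ≠ 0 :=
  (Polynomial.map_ne_zero_iff (algebraMap K _).injective).mpr u.denom_ne_zero

theorem isCoprime_map (u : RatFunc K) :
    IsCoprime (u.num.map (algebraMap K (AlgebraicClosure K)))
      (u.denom.map (algebraMap K (AlgebraicClosure K))) :=
  u.isCoprime_num_denom.map (Polynomial.mapRingHom (algebraMap K (AlgebraicClosure K)))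

theorem HasForm.ne_C (h2 : (2 : K) ≠ 0) (h : I.HasForm u 1) : ¬ ∃ c, u = RatFunc.C c := by
  rintro ⟨c, rfl⟩
  have := h.hasGeomForm.natDegree_lt h2 (denom_map_ne_zero _) (isCoprime_map _)
  simp at this

theorem HasForm.derivFrac_ne_zero (h2 : (2 : K) ≠ 0) (h : I.HasForm u 1) : derivFrac u ≠ 0 := by
  have hw := h.hasGeomForm.wronskian_ne_zero h2 (denom_map_ne_zero u)
  rw [derivative_map, derivative_map, ← Polynomial.map_mul, ← Polynomial.map_mul,
      ← Polynomial.map_sub, Ne, Polynomial.map_eq_zero] at hw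
  exact div_ne_zero (RatFunc.algebraMap_ne_zero hw)
    (RatFunc.algebraMap_ne_zero (pow_ne_zero 2 u.denom_ne_zero))

/-- If `f = p / q`, then `g = p (U, V) / q (U, V)`, as seen by comparing values. The point to secure
is that `q` does not vanish at the image of a generic point. -/
theorem HasForm.pullback_mem (h2 : (2 : K) ≠ 0) (h : I.HasForm u 1)
    {f : E'.toAffine.FunctionField} {g : E.toAffine.FunctionField} (hfg : I.IsPullback f g) :
    g ∈ IntermediateField.adjoin K
      {E.ratFuncHom h2 u, E.yFun * E.ratFuncHom h2 (derivFrac u)} := by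
  set U := E.ratFuncHom h2 u with hU
  set V := E.yFun * E.ratFuncHom h2 (derivFrac u) with hV
  obtain ⟨p, q, hq, hf⟩ := exists_aevalAeval_mul_eq f
  obtain ⟨N, hN, hNq⟩ := exists_norm E' hq
  have hM : aeval U N ≠ 0 := by
    rw [hU, aeval_algHom_apply, _root_.map_ne_zero]
    intro h0
    exact hN ((transcendental_iff.mp (RatFunc.transcendental_of_ne_C u (h.ne_C h2))) N h0)
  -- Where the inverse of `N (U)` has a value, `N` is non-zero at the image abscissa, and therefore
  -- so is `q` at the image point. The inverse makes sense since `u` is not constant.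
  obtain ⟨e, he, heM⟩ := WeierstrassCurve.exists_hasValueAt (aeval U N)⁻¹
  set d := u.denom.map (algebraMap K (AlgebraicClosure K)) with hd
  have hde : d * e ≠ 0 := mul_ne_zero (denom_map_ne_zero u) he
  have key : ∀ x y (hxy : y ^ 2 = E.geomCubic.eval x), (d * e).eval x ≠ 0 → ∃ x' y',
      aevalAeval x' y' q ≠ 0 ∧ HasValueAt U x y x' ∧ HasValueAt V x y y' ∧
      HasValueAt g x y (aevalAeval x' y' p / aevalAeval x' y' q) := by
    intro x y hxy hx
    rw [eval_mul] at hx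
    have hxy' := (geomNonsingular_iff E x y).mpr hxy
    obtain ⟨x', y', h', hI, hx', hy'⟩ := h.exists_hasValueAt h2 hxy' (left_ne_zero_of_mul hx)
    obtain ⟨z, hz⟩ := heM x y hxy (right_ne_zero_of_mul hx)
    have hNx : aeval x' N ≠ 0 := by
      have h1 := (hx'.aeval N).mul hz
      rw [mul_inv_cancel₀ hM] at h1
      have h3 := h1.unique hxy (by simpa using hasValueAt_algebraMap (E := E) 1 x y)
      exact left_ne_zero_of_mul (h3 ▸ one_ne_zero)
    have hq' : aevalAeval x' y' q ≠ 0 := fun h0 =>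
      hNx (hNq x' y' ((geomNonsingular_iff E' x' y').mp h') h0)
    exact ⟨x', y', hq', hx', hy', hfg x y hxy' x' y' h' hI _
      (hasValueAt_iff.mpr ⟨p, q, hf, hq', rfl⟩)⟩
  have hT : aevalAeval U V q ≠ 0 := by
    intro h0
    apply hde
    refine Polynomial.funext fun x => ?_
    by_contra hx
    rw [eval_zero] at hx
    obtain ⟨y, hy⟩ := exists_geomNonsingular E x
    have hxy := (geomNonsingular_iff E x y).mp hy
    obtain ⟨x', y', hq', hx', hy', -⟩ := key x y hxy hx
    have h1 := hx'.aevalAeval hy' q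
    rw [h0] at h1
    exact hq' (h1.unique hxy (by simpa using hasValueAt_algebraMap (E := E) 0 x y))
  have hg : g * aevalAeval U V q = aevalAeval U V p := by
    rw [← sub_eq_zero]
    refine eq_zero_of_forall_hasValueAt_zero h2 hde fun x y hxy hx => ?_
    obtain ⟨x', y', hq', hx', hy', hgv⟩ := key x y hxy hx
    have h1 := (hgv.mul (hx'.aevalAeval hy' q)).sub (hx'.aevalAeval hy' p)
    rwa [div_mul_cancel₀ _ hq', sub_self] at h1
  have hUm : U ∈ IntermediateField.adjoin K {U, V} :=
    IntermediateField.subset_adjoin _ _ (Set.mem_insert _ _)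
  have hVm : V ∈ IntermediateField.adjoin K {U, V} :=
    IntermediateField.subset_adjoin _ _ (Set.mem_insert_of_mem _ rfl)
  have hmem : ∀ r : K[X][X], aevalAeval U V r ∈ IntermediateField.adjoin K {U, V} := by
    intro r
    induction r using Polynomial.induction_on' with
    | add p q hp hq =>
      rw [map_add]
      exact add_mem hp hq
    | monomial k c =>
      rw [← C_mul_X_pow_eq_monomial, map_mul, map_pow, aevalAeval_C, aevalAeval_Y]
      exact mul_mem (IntermediateField.aeval_mem _ hUm c) (pow_mem hVm k)
  rw [eq_div_of_mul_eq hT hg]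
  exact div_mem (hmem p) (hmem q)

theorem HasForm.pullbackField_eq (h2 : (2 : K) ≠ 0) (h : I.HasForm u 1) :
    I.pullbackField = IntermediateField.adjoin K
      {E.ratFuncHom h2 u, E.yFun * E.ratFuncHom h2 (derivFrac u)} := by
  have hval : ∀ (x y : AlgebraicClosure K)
      (hxy : (E.baseChange (AlgebraicClosure K)).toAffine.Nonsingular x y) (x' y')
      (h' : (E'.baseChange (AlgebraicClosure K)).toAffine.Nonsingular x' y'),
      I.toHom (.some x y hxy) = .some x' y' h' → HasValueAt (E.ratFuncHom h2 u) x y x' ∧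
        HasValueAt (E.yFun * E.ratFuncHom h2 (derivFrac u)) x y y' := by
    intro x y hxy x' y' h' hI
    -- An affine image excludes a pole of `u`, so `U` and `V` are pullbacks at every point that the
    -- definition tests, not only generically.
    have hx : (u.denom.map (algebraMap K (AlgebraicClosure K))).eval x ≠ 0 := by
      intro h0
      have := h.hasGeomForm.apply_eq_zero h2 (denom_map_ne_zero u) (isCoprime_map u) hxy h0
      rw [hI] at this
      exact Affine.Point.some_ne_zero _ this
    obtain ⟨x'', y'', h'', hI', hu, hv⟩ := h.exists_hasValueAt h2 hxy hx
    have := Affine.Point.some.inj (hI.symm.trans hI')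
    rw [this.1, this.2]
    exact ⟨hu, hv⟩
  apply le_antisymm
  · rw [pullbackField, IntermediateField.adjoin_le_iff]
    rintro g ⟨f, hfg⟩
    exact h.pullback_mem h2 hfg
  · rw [IntermediateField.adjoin_le_iff]
    rintro g (rfl | rfl)
    · refine IntermediateField.subset_adjoin _ _ ⟨E'.xFun, fun x y hxy x' y' h' hI z hz => ?_⟩
      rw [hz.unique ((geomNonsingular_iff E' x' y').mp h') (hasValueAt_xFun x' y')]
      exact (hval x y hxy x' y' h' hI).1
    · refine IntermediateField.subset_adjoin _ _ ⟨E'.yFun, fun x y hxy x' y' h' hI z hz => ?_⟩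
      rw [hz.unique ((geomNonsingular_iff E' x' y').mp h') (hasValueAt_yFun x' y')]
      exact (hval x y hxy x' y' h' hI).2

theorem HasForm.degree_eq (h2 : (2 : K) ≠ 0) (h : I.HasForm u 1) :
    I.degree = max u.num.natDegree u.denom.natDegree := by
  rw [degree, h.pullbackField_eq h2]
  refine finrank_adjoin_pair h2 (h.derivFrac_ne_zero h2) ?_
  set U := E.ratFuncHom h2 u with hU
  have hV : (E.yFun * E.ratFuncHom h2 (derivFrac u)) ^ 2 =
      aeval U (X ^ 3 + C E'.a₄ * X + C E'.a₆) := by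
    rw [← sub_eq_zero]
    refine eq_zero_of_forall_hasValueAt_zero h2 (denom_map_ne_zero u) fun x y hxy hx => ?_
    obtain ⟨x', y', h', -, hx', hy'⟩ :=
      h.exists_hasValueAt h2 ((geomNonsingular_iff E x y).mpr hxy) hx
    convert (hy'.pow 2).sub (hx'.aeval (X ^ 3 + C E'.a₄ * X + C E'.a₆)) using 1
    rw [(geomNonsingular_iff E' x' y').mp h', eval_geomCubic]
    simp
  rw [hV]
  exact IntermediateField.aeval_mem _ (IntermediateField.mem_adjoin_simple_self K U) _

end Isogeny
end WeierstrassCurve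

/-! ### Descent to `K` and conclusion -/

namespace Polynomial

theorem veluDefect_map {F L : Type*} [Field F] [Field L] (φ : F →+* L) (f g n d : F[X]) :
    (veluDefect f g n d).map φ = veluDefect (f.map φ) (g.map φ) (n.map φ) (d.map φ) := by
  simp [veluDefect, Polynomial.map_sub, Polynomial.map_mul, Polynomial.map_pow, derivative_map]

theorem ratFunc_eq_of_veluDefect_eq_zero {F : Type*} [Field F] {n d : F[X]} {A B c s : F}
    (hd : d ≠ 0) (h : veluDefect (X ^ 3 + C A * X + C B) (C c * X - C s) n d = 0) :
    algebraMap F[X] (RatFunc F) n / algebraMap F[X] (RatFunc F) d =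
      RatFunc.C c * RatFunc.X - RatFunc.C s
        - (3 * RatFunc.X ^ 2 + RatFunc.C A) *
          (algebraMap F[X] (RatFunc F) (derivative d) / algebraMap F[X] (RatFunc F) d)
        - 2 * (RatFunc.X ^ 3 + RatFunc.C A * RatFunc.X + RatFunc.C B) *
          RatFunc.deriv
            (algebraMap F[X] (RatFunc F) (derivative d) / algebraMap F[X] (RatFunc F) d) := by
  have hd' : algebraMap F[X] (RatFunc F) d ≠ 0 := RatFunc.algebraMap_ne_zero hd
  have hder : derivative (X ^ 3 + C A * X + C B) = (3 * X ^ 2 + C A : F[X]) := by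
    simp only [derivative_add, derivative_mul, derivative_X_pow, derivative_C, derivative_X]
    simp only [Nat.cast_ofNat, map_ofNat]
    ring
  rw [veluDefect, hder] at h
  have h' := congrArg (algebraMap F[X] (RatFunc F)) h
  simp only [map_sub, map_add, map_mul, map_pow, map_ofNat, map_zero, RatFunc.algebraMap_X,
    RatFunc.algebraMap_C] at h'
  rw [RatFunc.deriv_div _ _ hd]
  field_simp
  linear_combination -h'

end Polynomial

end

theorem mainTheorem3 {K : Type*} [Field K] (h2 : (2 : K) ≠ 0) (h3 : (3 : K) ≠ 0)
    (E E' : WeierstrassCurve K) [E.IsElliptic] [E'.IsElliptic] [E.IsShortNF] [E'.IsShortNF]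
    (I : WeierstrassCurve.Isogeny E E') (hI : I.IsNormalized) (ℓ : ℕ) (hℓ : I.degree = ℓ) :
    I.kernelStar.Finite ∧
    ∃ (N D : K[X]) (σ : K),
      D.map (algebraMap K (AlgebraicClosure K)) =
        ∏ᶠ Q ∈ I.kernelStar, (X - C (WeierstrassCurve.GeomPoint.abscissa Q)) ∧
      D.Monic ∧ D.natDegree + 1 = ℓ ∧
      algebraMap K (AlgebraicClosure K) σ =
        ∑ᶠ Q ∈ I.kernelStar, WeierstrassCurve.GeomPoint.abscissa Q ∧
      D.nextCoeff = -σ ∧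
      (algebraMap K[X] (RatFunc K) N / algebraMap K[X] (RatFunc K) D =
        (ℓ : RatFunc K) * RatFunc.X - RatFunc.C σ
          - (3 * RatFunc.X ^ 2 + RatFunc.C E.a₄) *
            (algebraMap K[X] (RatFunc K) (derivative D) / algebraMap K[X] (RatFunc K) D)
          - 2 * (RatFunc.X ^ 3 + RatFunc.C E.a₄ * RatFunc.X + RatFunc.C E.a₆) *
            RatFunc.deriv
              (algebraMap K[X] (RatFunc K) (derivative D) / algebraMap K[X] (RatFunc K) D)) ∧
      I.HasForm (algebraMap K[X] (RatFunc K) N / algebraMap K[X] (RatFunc K) D) 1 := by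
  obtain ⟨u, hu⟩ := hI
  set φ := algebraMap K (AlgebraicClosure K) with hφ
  have hg := hu.hasGeomForm
  have hd0 := WeierstrassCurve.Isogeny.denom_map_ne_zero u
  have hc := WeierstrassCurve.Isogeny.isCoprime_map u
  rw [← hφ] at hg hd0 hc
  have hmon : (u.denom.map φ).Monic := u.monic_denom.map φ
  have hode := hg.isShortODE hd0
  have hlt := hg.natDegree_lt h2 hd0 hc
  have h2' : (2 : AlgebraicClosure K) ≠ 0 := by
    rw [← map_ofNat φ 2]
    exact (_root_.map_ne_zero _).mpr h2
  have h3' : (3 : AlgebraicClosure K) ≠ 0 := by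
    rw [← map_ofNat φ 3]
    exact (_root_.map_ne_zero _).mpr h3
  -- The numerator has degree one more than the denominator, so it realizes the maximum that
  -- computes `ℓ`.
  have hdeg : u.denom.natDegree + 1 = ℓ := by
    obtain ⟨s, hs, hn⟩ := hode.exists_eq_X_mul_add h3' hmon hlt
    rw [mem_degreeLT] at hs
    have hXd : (X * u.denom.map φ).natDegree = u.denom.natDegree + 1 := by
      rw [natDegree_X_mul hd0, natDegree_map]
    have := congrArg natDegree hn
    rw [natDegree_add_eq_left_of_degree_lt, hXd, natDegree_map] at this
    · rw [← hℓ, hu.degree_eq h2, this]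
      simp
    · rw [degree_eq_natDegree (mul_ne_zero X_ne_zero hd0), hXd]
      refine hs.trans ?_
      rw [natDegree_map]
      exact_mod_cast Nat.lt_succ_self _
  have hdef : veluDefect (X ^ 3 + C E.a₄ * X + C E.a₆) (C (ℓ : K) * X - C (-u.denom.nextCoeff))
      u.num u.denom = 0 := by
    -- The numerator and denominator of `u` already have coefficients in `K`; only the vanishing is
    -- tested over the closure, so no Galois descent is needed.
    rw [← Polynomial.map_eq_zero φ, veluDefect_map]
    have := hode.veluDefect_eq_zero h2' h3' hmon hc hlt
    rw [natDegree_map, nextCoeff_map φ.injective] at this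
    rw [← this, ← hdeg]
    simp [hφ]
  refine ⟨hg.finite_kernelStar h2 hd0 hc, u.num, u.denom, -u.denom.nextCoeff,
    hg.finprod_kernelStar h2 hmon hc, u.monic_denom, hdeg, ?_, by rw [neg_neg], ?_, ?_⟩
  · rw [hg.finsum_kernelStar h2 hmon hc, nextCoeff_map φ.injective, map_neg]
  · rw [ratFunc_eq_of_veluDefect_eq_zero u.denom_ne_zero hdef, map_natCast]
  · rwa [RatFunc.num_div_denom]
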